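/- Let $k$ be a field and let $H$ be a finite-dimensional quasi-Hopf algebra over $k$: a unital associative $k$-algebra with unital algebra morphisms $\Delta:H\to H\otimes H$, $\varepsilon:H\to k$ and an invertible $\phi=\sum X\otimes Y\otimes Z\in H^{\otimes 3}$, $\phi^{-1}=\sum\bar X\otimes\bar Y\otimes\bar Z$, such that $(\mathrm{id}\otimes\Delta)(\Delta(a))\,\phi=\phi\,(\Delta\otimes\mathrm{id})(\Delta(a))$, $(\mathrm{id}\otimes\mathrm{id}\otimes\Delta)(\phi)(\Delta\otimes\mathrm{id}\otimes\mathrm{id})(\phi)=(1\otimes\phi)(\mathrm{id}\otimes\Delta\otimes\mathrm{id})(\phi)(\phi\otimes1)$, $(\varepsilon\otimes\mathrm{id})\Delta=\mathrm{id}=(\mathrm{id}\otimes\varepsilon)\Delta$, $(\mathrm{id}\otimes\varepsilon\otimes\mathrm{id})(\phi)=1\otimes1$, together with an invertible unital anti-homomorphism $S:H\to H$ and $\alpha,\beta\in H$ such that $S(a_{(1)})\alpha a_{(2)}=\varepsilon(a)\alpha$, $a_{(1)}\beta S(a_{(2)})=\varepsilon(a)\beta$, $\sum X\beta S(Y)\alpha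 Z=1=\sum S(\bar X)\alpha\bar Y\beta S(\bar Z)$. **Cointegrals.** Let $\hat H=\mathrm{Hom}_k(H,k)$, with the $H$-bimodule structure $(a\cdot\psi\cdot b)(m)=\psi(S^{-1}(a)\,m\,S(b))$. Write $x^{21}$ for the flip of $x\in H\otimes H$ and put $$\gamma_0=\sum (S(U)\otimes S(T))(\alpha\otimes\alpha)(V\otimes W),\qquad \sum T\otimes U\otimes V\otimes W=(1\otimes\phi^{-1})(\mathrm{id}\otimes\mathrm{id}\otimes\Delta)(\phi),$$ $$f=\sum (S\otimes S)(\Delta^{op}(\bar X))\,\gamma_0\,\Delta(\bar Y\beta S(\bar Z)),\qquad h=(S^{-1}\otimes S^{-1})(f^{21}),$$ $$q=\sum X\otimes S^{-1}(\alpha Z)Y,\qquad p=\sum\bar X\otimes\bar Y\beta S(\bar Z),$$ $$\bar\Delta(a)=(S^{-1}\otimes S^{-1})(p^{21})\,h\;\Delta(a)\;f^{-1}\,(S\otimes S)(q^{21})$$ ($f$ is invertible by a theorem of Drinfeld). Define $\rho:\hat H\to\hat H\otimes H\cong\mathrm{Hom}_k(H,H)$, $\rho(\psi)=\psi_{(0)}\otimes\psi_{(1)}$,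 by $\rho(\psi)(m)=(\mathrm{id}\otimes\psi)(\bar\Delta(m))$, and $E:\hat H\to\hat H$ by $E(\psi)=\sum q^1\cdot\psi_{(0)}\cdot\beta S(q^2\psi_{(1)})$. The space of left cointegrals on $H$ is $\mathcal L=E(\hat H)$. Put $a\triangleright\lambda=E(a\cdot\lambda)$ for $a\in H$, $\lambda\in\mathcal L$. **Modulus.** A functional $\omega\in\hat H$ is nondegenerate if the bilinear form $(a,b)\mapsto\omega(ab)$ is; its modular automorphism is then the automorphism $\theta_\omega$ of $H$ with $\omega(ab)=\omega(b\,\theta_\omega(a))$ for all $a,b\in H$. The modulus of $H$ is the algebra morphism $\mu=\varepsilon\circ\theta_\omega^{-1}:H\to k$ for a nondegenerate $\omega$, and $H$ is unimodular if $\mu=\varepsilon$. For $a\in H$ write $a\leftharpoonup\mu=\mu(a_{(1)})a_{(2)}$. **Statement.** The modulus $\mu$ exists and does not depend on the choice of $\omega$, and there is a unique algebra morphism $\gamma:H\to k$ with $a\triangleright\lambda=\gamma(a)\lambda$ for all $a\in H$, $\lambda\in\mathcal L$. Moreover: 1. $\gamma=\mu$. 2. Every nonzero $\lambda\in\mathcal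 L$ is nondegenerate, and its modular automorphism is $\theta_\lambda(a)=S\bigl(S(a)\leftharpoonup\mu\bigr)$, $a\in H$. 3. $H$ is unimodular if and only if $\lambda(ab)=\lambda(b\,S^2(a))$ for all $\lambda\in\mathcal L$ and all $a,b\in H$. -/

import Mathlib

open scoped TensorProduct

universe u v

noncomputable section

/-- An anti-automorphism of an algebra, given as an isomorphism onto the opposite algebra, viewed as a
linear automorphism of the underlying space. -/
def antiLinear {k : Type u} {H : Type v} [Field k] [Ring H] [Algebra k H]
    (S : H ≃ₐ[k] Hᵐᵒᵖ) : H ≃ₗ[k] H :=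
  S.toLinearEquiv.trans (MulOpposite.opLinearEquiv k).symm

/-- A quasi-Hopf algebra structure, with invertible antipode, on a unital associative algebra `H` over
a field `k`. Tensor powers are bracketed to the right: `H ⊗ (H ⊗ H)`, `H ⊗ (H ⊗ (H ⊗ H))`. Sums over
the components of a tensor are written with linear maps: `LinearMap.mul'` is the multiplication
`H ⊗ H → H`, `LinearMap.mulRight k b` is `x ↦ x b` and `LinearMap.mulLeft k b` is `x ↦ b x`. -/
structure QuasiHopfAlgebra (k : Type u) (H : Type v) [Field k] [Ring H] [Algebra k H] where
  /-- the coproduct `Δ` -/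
  comul : H →ₐ[k] H ⊗[k] H
  /-- the counit `ε` -/
  counit : H →ₐ[k] k
  /-- the reassociator `φ = ∑ X ⊗ Y ⊗ Z`, an invertible element of `H ⊗ H ⊗ H` -/
  phi : (H ⊗[k] (H ⊗[k] H))ˣ
  /-- the antipode `S`, an invertible unital anti-homomorphism -/
  antipode : H ≃ₐ[k] Hᵐᵒᵖ
  /-- the element `α` -/
  alpha : H
  /-- the element `β` -/
  beta : H
  /-- `(id ⊗ Δ)(Δ(a)) φ = φ (Δ ⊗ id)(Δ(a))` -/
  quasi_coassoc : ∀ a : H,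
    Algebra.TensorProduct.map (AlgHom.id k H) comul (comul a) * phi.val =
      phi.val * Algebra.TensorProduct.assoc k k k H H H
          (Algebra.TensorProduct.map comul (AlgHom.id k H) (comul a))
  /-- `(id ⊗ id ⊗ Δ)(φ) (Δ ⊗ id ⊗ id)(φ) = (1 ⊗ φ) (id ⊗ Δ ⊗ id)(φ) (φ ⊗ 1)` -/
  pentagon :
    Algebra.TensorProduct.map (AlgHom.id k H)
        (Algebra.TensorProduct.map (AlgHom.id k H) comul) phi.val *
      Algebra.TensorProduct.assoc k k k H H (H ⊗[k] H)
        (Algebra.TensorProduct.map comul (AlgHom.id k (H ⊗[k] H)) phi.val) =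
    ((1 : H) ⊗ₜ[k] phi.val) *
      Algebra.TensorProduct.map (AlgHom.id k H)
        ((Algebra.TensorProduct.assoc k k k H H H).toAlgHom.comp
          (Algebra.TensorProduct.map comul (AlgHom.id k H))) phi.val *
      Algebra.TensorProduct.map (AlgHom.id k H)
        (Algebra.TensorProduct.map (AlgHom.id k H)
          (Algebra.TensorProduct.includeLeft : H →ₐ[k] H ⊗[k] H)) phi.val
  /-- `(ε ⊗ id)(Δ(a)) = a` -/
  counit_left : ∀ a : H, Algebra.TensorProduct.lid k H
    (Algebra.TensorProduct.map counit (AlgHom.id k H) (comul a)) = a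
  /-- `(id ⊗ ε)(Δ(a)) = a` -/
  counit_right : ∀ a : H, Algebra.TensorProduct.rid k k H
    (Algebra.TensorProduct.map (AlgHom.id k H) counit (comul a)) = a
  /-- `(id ⊗ ε ⊗ id)(φ) = 1 ⊗ 1` -/
  counit_phi : Algebra.TensorProduct.map (AlgHom.id k H)
    ((Algebra.TensorProduct.lid k H).toAlgHom.comp
      (Algebra.TensorProduct.map counit (AlgHom.id k H))) phi.val = 1
  /-- `S(a₍₁₎) α a₍₂₎ = ε(a) α` -/
  antipode_alpha : ∀ a : H,
    LinearMap.mul' k H (TensorProduct.map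
      (LinearMap.mulRight k alpha ∘ₗ (antiLinear antipode).toLinearMap) LinearMap.id (comul a)) =
      counit a • alpha
  /-- `a₍₁₎ β S(a₍₂₎) = ε(a) β` -/
  antipode_beta : ∀ a : H,
    LinearMap.mul' k H (TensorProduct.map
      (LinearMap.mulRight k beta) (antiLinear antipode).toLinearMap (comul a)) =
      counit a • beta
  /-- `∑ X β S(Y) α Z = 1` -/
  antipode_phi :
    LinearMap.mul' k H (TensorProduct.map (LinearMap.mulRight k beta)
      (LinearMap.mul' k H ∘ₗ TensorProduct.map
        (LinearMap.mulRight k alpha ∘ₗ (antiLinear antipode).toLinearMap) LinearMap.id)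
      phi.val) = 1
  /-- `∑ S(X̄) α Ȳ β S(Z̄) = 1`, where `φ⁻¹ = ∑ X̄ ⊗ Ȳ ⊗ Z̄` -/
  antipode_phi_inv :
    LinearMap.mul' k H (TensorProduct.map
      (LinearMap.mulRight k alpha ∘ₗ (antiLinear antipode).toLinearMap)
      (LinearMap.mul' k H ∘ₗ TensorProduct.map
        (LinearMap.mulRight k beta) (antiLinear antipode).toLinearMap)
      phi.inv) = 1

section Frobenius

variable {k : Type u} {H : Type v} [Field k] [Ring H] [Algebra k H]

/-- A linear functional `ω` on `H` is nondegenerate if the bilinear form `(a, b) ↦ ω(ab)` is. -/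
def IsNondegenerateFunctional (ω : Module.Dual k H) : Prop :=
  LinearMap.Nondegenerate ((LinearMap.mul k H).compr₂ ω)

/-- `ω_L : H → Ĥ`, `ω_L(a)(b) = ω(ab)`. -/
def leftForm (ω : Module.Dual k H) : H →ₗ[k] Module.Dual k H :=
  (LinearMap.mul k H).compr₂ ω

/-- `ω_R : H → Ĥ`, `ω_R(a)(b) = ω(ba)`. -/
def rightForm (ω : Module.Dual k H) : H →ₗ[k] Module.Dual k H :=
  ((LinearMap.mul k H).compr₂ ω).flip

@[simp] theorem leftForm_apply (ω : Module.Dual k H) (a b : H) : leftForm ω a b = ω (a * b) := rfl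

@[simp] theorem rightForm_apply (ω : Module.Dual k H) (a b : H) : rightForm ω a b = ω (b * a) := rfl

theorem leftForm_injective {ω : Module.Dual k H} (hω : IsNondegenerateFunctional ω) :
    Function.Injective (leftForm ω) :=
  LinearMap.ker_eq_bot.mp (LinearMap.separatingLeft_iff_ker_eq_bot.mp hω.1)

theorem rightForm_injective {ω : Module.Dual k H} (hω : IsNondegenerateFunctional ω) :
    Function.Injective (rightForm ω) :=
  LinearMap.ker_eq_bot.mp (LinearMap.separatingRight_iff_flip_ker_eq_bot.mp hω.2)

variable [FiniteDimensional k H]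

/-- `ω_L` as a linear isomorphism, for a nondegenerate functional on a finite-dimensional algebra. -/
def leftFormEquiv (ω : Module.Dual k H) (hω : IsNondegenerateFunctional ω) :
    H ≃ₗ[k] Module.Dual k H :=
  LinearEquiv.ofInjectiveOfFinrankEq (leftForm ω) (leftForm_injective hω)
    Subspace.dual_finrank_eq.symm

/-- `ω_R` as a linear isomorphism, for a nondegenerate functional on a finite-dimensional algebra. -/
def rightFormEquiv (ω : Module.Dual k H) (hω : IsNondegenerateFunctional ω) :
    H ≃ₗ[k] Module.Dual k H :=
  LinearEquiv.ofInjectiveOfFinrankEq (rightForm ω) (rightForm_injective hω)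
    Subspace.dual_finrank_eq.symm

/-- The linear map `ω_R⁻¹ ∘ ω_L`. -/
def modularLinear (ω : Module.Dual k H) (hω : IsNondegenerateFunctional ω) : H ≃ₗ[k] H :=
  (leftFormEquiv ω hω).trans (rightFormEquiv ω hω).symm

/-- The defining relation `ω(ab) = ω(b θ(a))` of `θ = ω_R⁻¹ ∘ ω_L`. -/
theorem modularLinear_spec (ω : Module.Dual k H) (hω : IsNondegenerateFunctional ω) (a b : H) :
    ω (b * modularLinear ω hω a) = ω (a * b) := by
  have h : rightFormEquiv ω hω (modularLinear ω hω a) = leftFormEquiv ω hω a := by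
    simp [modularLinear]
  exact LinearMap.congr_fun h b

/-- The modular (Nakayama) automorphism `θ_ω = ω_R⁻¹ ∘ ω_L` of a nondegenerate functional `ω`. -/
def modularAut (ω : Module.Dual k H) (hω : IsNondegenerateFunctional ω) : H ≃ₐ[k] H :=
  AlgEquiv.ofLinearEquiv (modularLinear ω hω)
    (by
      apply rightForm_injective hω
      ext b
      simp [modularLinear_spec])
    (by
      intro x y
      apply rightForm_injective hω
      ext b
      simp only [rightForm_apply, modularLinear_spec]
      rw [← mul_assoc b, modularLinear_spec, ← mul_assoc y, modularLinear_spec, mul_assoc])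

end Frobenius

namespace QuasiHopfAlgebra

variable {k : Type u} {H : Type v} [Field k] [Ring H] [Algebra k H] (Q : QuasiHopfAlgebra k H)

/-- The antipode `S` as a linear automorphism of `H`. -/
def S : H ≃ₗ[k] H := antiLinear Q.antipode

/-- `a ↼ χ = χ(a₍₁₎) a₍₂₎`. -/
def hit (a : H) (χ : Module.Dual k H) : H :=
  TensorProduct.lid k H (TensorProduct.map χ LinearMap.id (Q.comul a))

/-- `S ⊗ S` on `H ⊗ H`. -/
def SS : H ⊗[k] H ≃ₗ[k] H ⊗[k] H := TensorProduct.congr Q.S Q.S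

/-- The flip `x ⊗ y ↦ y ⊗ x` on `H ⊗ H`. -/
def flip : H ⊗[k] H ≃ₗ[k] H ⊗[k] H := TensorProduct.comm k H H

/-- `T ⊗ U ⊗ V ⊗ W = (1 ⊗ φ⁻¹) (id ⊗ id ⊗ Δ)(φ)`. -/
def tensorTUVW : H ⊗[k] (H ⊗[k] (H ⊗[k] H)) :=
  ((1 : H) ⊗ₜ[k] Q.phi.inv) *
    Algebra.TensorProduct.map (AlgHom.id k H)
      (Algebra.TensorProduct.map (AlgHom.id k H) Q.comul) Q.phi.val

/-- `γ = ∑ (S(U) ⊗ S(T)) (α ⊗ α) (V ⊗ W)`. -/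
def gamma : H ⊗[k] H :=
  LinearMap.mul' k (H ⊗[k] H) (TensorProduct.map
    (LinearMap.mulRight k (Q.alpha ⊗ₜ[k] Q.alpha) ∘ₗ Q.SS.toLinearMap ∘ₗ
      (flip : H ⊗[k] H ≃ₗ[k] H ⊗[k] H).toLinearMap)
    LinearMap.id
    ((TensorProduct.assoc k H H (H ⊗[k] H)).symm Q.tensorTUVW))

/-- Drinfeld's twist `f = ∑ (S ⊗ S)(Δᵒᵖ(X̄)) γ Δ(Ȳ β S(Z̄))`. -/
def f : H ⊗[k] H :=
  LinearMap.mul' k (H ⊗[k] H) (TensorProduct.map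
    (LinearMap.mulRight k Q.gamma ∘ₗ Q.SS.toLinearMap ∘ₗ
      (flip : H ⊗[k] H ≃ₗ[k] H ⊗[k] H).toLinearMap ∘ₗ Q.comul.toLinearMap)
    (Q.comul.toLinearMap ∘ₗ LinearMap.mul' k H ∘ₗ
      TensorProduct.map (LinearMap.mulRight k Q.beta) Q.S.toLinearMap)
    Q.phi.inv)

/-- `f⁻¹`, the two-sided inverse of the twist `f`, which is invertible by a theorem of Drinfeld. -/
def fInv : H ⊗[k] H := Ring.inverse Q.f

/-- `h = (S⁻¹ ⊗ S⁻¹)(f²¹)`. -/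
def h : H ⊗[k] H := Q.SS.symm (flip Q.f)

/-- `q_R = ∑ X ⊗ S⁻¹(α Z) Y`. -/
def qR : H ⊗[k] H :=
  TensorProduct.map LinearMap.id
    (LinearMap.mul' k H ∘ₗ
      TensorProduct.map (Q.S.symm.toLinearMap ∘ₗ LinearMap.mulLeft k Q.alpha) LinearMap.id ∘ₗ
      (flip : H ⊗[k] H ≃ₗ[k] H ⊗[k] H).toLinearMap)
    Q.phi.val

/-- `p_R = ∑ X̄ ⊗ Ȳ β S(Z̄)`. -/
def pR : H ⊗[k] H :=
  TensorProduct.map LinearMap.id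
    (LinearMap.mul' k H ∘ₗ TensorProduct.map (LinearMap.mulRight k Q.beta) Q.S.toLinearMap)
    Q.phi.inv

/-- `U = f⁻¹ (S ⊗ S)(q_R²¹)`. -/
def U : H ⊗[k] H := Q.fInv * Q.SS (flip Q.qR)

/-- `V = (S⁻¹ ⊗ S⁻¹)(p_R²¹) h`. -/
def V : H ⊗[k] H := Q.SS.symm (flip Q.pR) * Q.h

/-- The deformed coproduct `Δ̄(a) = V Δ(a) U`. -/
def comulBar : H →ₗ[k] H ⊗[k] H :=
  LinearMap.mulLeft k Q.V ∘ₗ LinearMap.mulRight k Q.U ∘ₗ Q.comul.toLinearMap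

/-- The left action `(a · ψ)(m) = ψ(S⁻¹(a) m)` of `H` on its dual. -/
def dualLeft : H →ₗ[k] Module.Dual k H →ₗ[k] Module.Dual k H :=
  LinearMap.mk₂ k (fun a ψ => ψ ∘ₗ LinearMap.mulLeft k (Q.S.symm a))
    (fun _ _ _ => by ext; simp [add_mul]) (fun _ _ _ => by ext; simp)
    (fun _ _ _ => by ext; simp) (fun _ _ _ => by ext; simp)

/-- The right action `(ψ · b)(m) = ψ(m S(b))` of `H` on its dual. -/
def dualRight : Module.Dual k H →ₗ[k] H →ₗ[k] Module.Dual k H :=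
  LinearMap.mk₂ k (fun ψ b => ψ ∘ₗ LinearMap.mulRight k (Q.S b))
    (fun _ _ _ => by ext; simp) (fun _ _ _ => by ext; simp)
    (fun _ _ _ => by ext; simp [mul_add]) (fun _ _ _ => by ext; simp)

@[simp] theorem dualLeft_apply (a : H) (ψ : Module.Dual k H) (m : H) :
    Q.dualLeft a ψ m = ψ (Q.S.symm a * m) := rfl

@[simp] theorem dualRight_apply (b : H) (ψ : Module.Dual k H) (m : H) :
    Q.dualRight ψ b m = ψ (m * Q.S b) := rfl

variable [FiniteDimensional k H]

/-- The right coaction `ρ : Ĥ → Ĥ ⊗ H`: under the identification `Ĥ ⊗ H ≅ Hom(H, H)`, it is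
`ρ(ψ)(m) = (id ⊗ ψ)(Δ̄(m))`. -/
def coaction : Module.Dual k H →ₗ[k] Module.Dual k H ⊗[k] H :=
  (dualTensorHomEquiv k H H).symm.toLinearMap ∘ₗ
    LinearMap.lcomp k H Q.comulBar ∘ₗ
    LinearMap.compRight k (TensorProduct.rid k H).toLinearMap ∘ₗ
    LinearMap.lTensorHom H

/-- The projection `E : Ĥ → Ĥ`, `E(ψ) = q_R¹ · ψ₍₀₎ · (β S(q_R² ψ₍₁₎))`. -/
def E : Module.Dual k H →ₗ[k] Module.Dual k H :=
  TensorProduct.lift Q.dualRight ∘ₗ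
    TensorProduct.map (TensorProduct.lift Q.dualLeft)
      (LinearMap.mulLeft k Q.beta ∘ₗ Q.S.toLinearMap ∘ₗ LinearMap.mul' k H) ∘ₗ
    (TensorProduct.tensorTensorTensorComm k H H (Module.Dual k H) H).toLinearMap ∘ₗ
    TensorProduct.mk k (H ⊗[k] H) (Module.Dual k H ⊗[k] H) Q.qR ∘ₗ
    Q.coaction

/-- The space `ℒ = E(Ĥ)` of left cointegrals on `H`: the coinvariants of the quasi-Hopf bimodule
`Ĥ`. -/
def leftCointegrals : Submodule k (Module.Dual k H) := LinearMap.range Q.E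

/-- `H` acts on `ℒ` by the character `γ`: one has `a ▷ lam = γ(a) lam` for all `a ∈ H` and
`lam ∈ ℒ`, where `a ▷ lam = E(a · lam)`. -/
def ActsOnCointegralsBy (γ : H →ₐ[k] k) : Prop :=
  ∀ a : H, ∀ lam ∈ Q.leftCointegrals, Q.E (Q.dualLeft a lam) = γ a • lam

/-- `μ` is the modulus of `H`: `μ = ε ∘ θ_ω⁻¹` for a nondegenerate functional `ω` on `H`. -/
def IsModulus (μ : H →ₐ[k] k) : Prop :=
  ∃ (ω : Module.Dual k H) (hω : IsNondegenerateFunctional ω),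
    μ = Q.counit.comp (modularAut ω hω).symm.toAlgHom

/-- `H` is unimodular: its modulus is the counit. -/
def IsUnimodular : Prop := Q.IsModulus Q.counit

end QuasiHopfAlgebra

end

/-!
# Left cointegrals and the modulus of a finite-dimensional quasi-Hopf algebra

The reason behind the theorem is that `Ĥ = Hom(H, k)`, with its two-sided action and the coaction
`ρ`, is a quasi-Hopf bimodule: `ρ(a · ψ · b) = Δ(a) ρ(ψ) Δ(b)` and
`(ρ ⊗ id) ρ(ψ) = φ⁻¹ ((id ⊗ Δ) ρ(ψ)) φ` (`coaction_dualLeft`, `coaction_dualRight`,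
`coaction_coassoc`). The structure theorem for such bimodules makes `Ĥ` the free right `H`-module on
its coinvariants `ℒ = E(Ĥ)`: one has `E(ψ · b) = ε(b) E(ψ)`, `E(ψ₀) · ψ₁ = ψ` and
`a · E(ψ) = E(a₁ · ψ) · a₂` (`E_dualRight`, `E_coaction`, `dualLeft_E`), and `λ ⊗ a` is recovered
from `λ · a` for `λ ∈ ℒ` (`rTensor_E_coaction`).

Since `Ĥ` and `H` have the same dimension, `ℒ` is then a line, and `a ↦ λ · a = λ(- S(a))` is
injective for `λ ≠ 0` in `ℒ`, which makes `λ` nondegenerate. The algebra `H` acts on the line `ℒ` by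
a character `γ`, and `a · λ = λ · (a ↼ γ)` says `λ(S⁻¹(a) m) = λ(m S(a ↼ γ))`, that is
`θ_λ(a) = S(S(a) ↼ γ)` (`modularAut_of_mem`). For every character, `γ(S(a ↼ γ)) = ε(a)`
(`character_S_hit`), so `γ ∘ θ_λ = ε` and `γ` is the modulus. It does not depend on the functional
because modular automorphisms of two nondegenerate functionals differ by an inner automorphism
(`comp_modularAut_symm_eq`).

The work lies in the bimodule property, that is, in the identities for `Δ̄ = V Δ(-) U`, where
`f U = q'` with `q' = (S ⊗ S)(q_R²¹)`, and `V` is the image of `f p_R` under the inverse of the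
anti-automorphism `σ(x ⊗ y) = S(y) ⊗ S(x)`. Two relations of the twist carry everything:
`f Δ(S(a)) = σ(Δ(a)) f` and `f Δ(S(X) α) (Y ⊗ Z) = q' (1 ⊗ α)` for `φ = X ⊗ Y ⊗ Z`
(`f_mul_comul_S`, `f_mul_phiEval`). They yield an explicit right inverse of `f`, hence Drinfeld's
theorem that `f` is invertible (`isUnit_f`), and a description of `U` that does not mention `f`:
`Δ(S(b₁)) U (b₂ ⊗ 1) = U (1 ⊗ S(b))` and `U (1 ⊗ α) = Δ(S(X) α) (Y ⊗ Z)` (`sandwich_U`,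
`U_mul_alpha`). The mirror image for `V` (`sandwich_V`, `beta_mul_V`) rests on the formula
`p_R = Δ(X β S(Y)) U (Z ⊗ 1)` (`betaU_phi`). An element subject to the first kind of relation is
determined by its product with `α` in the last factor, because `S(x̄) α ȳ β S(z̄) = 1` for
`φ⁻¹ = x̄ ⊗ ȳ ⊗ z̄` (`eq_of_mul_alpha_eq`). The coassociativity of `ρ` reduces in this way to the
pentagon (`U_cocycle`, `V_cocycle`).

Tensor identities are proved one slot at a time: each `have` of the form `∀ w, …` in the proofs
below is linear in `w` and is checked on pure tensors.
-/

noncomputable section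

-- Finding the ring structure on `H ⊗ (H ⊗ (H ⊗ H))` takes nested instance problems.
set_option maxSynthPendingDepth 3

namespace QuasiHopfAlgebra

/-! ### Linear maps on tensor products of algebras -/

section Sandwich

variable {k : Type u} [Field k]

/-- `TensorProduct.induction_on` without the case of `0`, which is the pure tensor `0 ⊗ 0`. -/
theorem tensor_induction {A B : Type*} [AddCommGroup A] [Module k A] [AddCommGroup B] [Module k B]
    {P : A ⊗[k] B → Prop} (x : A ⊗[k] B) (tmul : ∀ a b, P (a ⊗ₜ b))
    (add : ∀ x y, P x → P y → P (x + y)) : P x := by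
  induction x using TensorProduct.induction_on with
  | zero => simpa using tmul 0 0
  | tmul a b => exact tmul a b
  | add x y hx hy => exact add x y hx hy

theorem tensor_induction₃ {A B C : Type*} [AddCommGroup A] [Module k A] [AddCommGroup B]
    [Module k B] [AddCommGroup C] [Module k C]
    {P : A ⊗[k] (B ⊗[k] C) → Prop} (x : A ⊗[k] (B ⊗[k] C)) (tmul : ∀ a b c, P (a ⊗ₜ (b ⊗ₜ c)))
    (add : ∀ x y, P x → P y → P (x + y)) : P x := by
  induction x using tensor_induction with
  | add x y hx hy => exact add x y hx hy
  | tmul a w =>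
    induction w using tensor_induction with
    | tmul b c => exact tmul a b c
    | add x y hx hy => rw [TensorProduct.tmul_add]; exact add _ _ hx hy

variable {A B R : Type*} [AddCommGroup A] [Module k A] [AddCommGroup B] [Module k B]
  [Ring R] [Algebra k R]

/-- The linear map `a ⊗ b ↦ f(a) r g(b)`. When `f` is antimultiplicative and `g` multiplicative,
it is the orbit map of `r` under a right action of `A ⊗ B` on `R`; in the opposite situation it is
the orbit map under a left action. -/
def sandwich (f : A →ₗ[k] R) (g : B →ₗ[k] R) (r : R) : A ⊗[k] B →ₗ[k] R :=
  LinearMap.mul' k R ∘ₗ TensorProduct.map (LinearMap.mulRight k r ∘ₗ f) g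

@[simp] theorem sandwich_tmul (f : A →ₗ[k] R) (g : B →ₗ[k] R) (r : R) (a : A) (b : B) :
    sandwich f g r (a ⊗ₜ b) = f a * r * g b := rfl

theorem sandwich_smul (f : A →ₗ[k] R) (g : B →ₗ[k] R) (c : k) (r : R) (w : A ⊗[k] B) :
    sandwich f g (c • r) w = c • sandwich f g r w := by
  induction w using tensor_induction with
  | tmul a b => simp
  | add x y hx hy => simp only [map_add, hx, hy, smul_add]

theorem sandwich_add (f : A →ₗ[k] R) (g : B →ₗ[k] R) (r s : R) (w : A ⊗[k] B) :
    sandwich f g (r + s) w = sandwich f g r w + sandwich f g s w := by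
  induction w using tensor_induction with
  | tmul a b => simp [mul_add, add_mul]
  | add x y hx hy => simp only [map_add, hx, hy]; abel

end Sandwich

section Action

variable {k : Type u} [Field k] {A B R : Type*} [Ring A] [Algebra k A] [Ring B] [Algebra k B]
  [Ring R] [Algebra k R]

theorem sandwich_mul_right {f : A →ₗ[k] R} {g : B →ₗ[k] R} (hf : ∀ x y, f (x * y) = f y * f x)
    (hg : ∀ x y, g (x * y) = g x * g y) (r : R) (w w' : A ⊗[k] B) :
    sandwich f g r (w * w') = sandwich f g (sandwich f g r w) w' := by
  induction w using tensor_induction with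
  | add x y hx hy => simp only [map_add, add_mul, hx, hy, sandwich_add]
  | tmul a b =>
    induction w' using tensor_induction with
    | add x y hx hy => simp only [map_add, mul_add, hx, hy]
    | tmul a' b' => simp [hf, hg, mul_assoc]

theorem sandwich_mul_left {f : A →ₗ[k] R} {g : B →ₗ[k] R} (hf : ∀ x y, f (x * y) = f x * f y)
    (hg : ∀ x y, g (x * y) = g y * g x) (r : R) (w w' : A ⊗[k] B) :
    sandwich f g r (w * w') = sandwich f g (sandwich f g r w') w := by
  induction w' using tensor_induction with
  | add x y hx hy => simp only [map_add, mul_add, hx, hy, sandwich_add]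
  | tmul a b =>
    induction w using tensor_induction with
    | add x y hx hy => simp only [map_add, add_mul, hx, hy]
    | tmul a' b' => simp [hf, hg, mul_assoc]

end Action

variable {k : Type u} {H : Type v} [Field k] [Ring H] [Algebra k H] (Q : QuasiHopfAlgebra k H)

/-! ### The antipode -/

theorem S_mul (a b : H) : Q.S (a * b) = Q.S b * Q.S a := by
  simp [S, antiLinear]

@[simp] theorem S_one : Q.S 1 = 1 := by
  simp [S, antiLinear]

theorem S_symm_mul (a b : H) : Q.S.symm (a * b) = Q.S.symm b * Q.S.symm a := by
  apply Q.S.injective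
  simp [S_mul]

@[simp] theorem S_symm_one : Q.S.symm 1 = 1 := by
  apply Q.S.injective
  simp

/-- The anti-homomorphism `σ(x ⊗ y) = S(y) ⊗ S(x)` of `H ⊗ H`. -/
def flipS : H ⊗[k] H ≃ₗ[k] H ⊗[k] H := flip.trans Q.SS

@[simp] theorem flipS_tmul (a b : H) : Q.flipS (a ⊗ₜ b) = Q.S b ⊗ₜ Q.S a := rfl

@[simp] theorem flipS_one : Q.flipS 1 = 1 := by
  simp [Algebra.TensorProduct.one_def]

theorem flipS_mul (x y : H ⊗[k] H) : Q.flipS (x * y) = Q.flipS y * Q.flipS x := by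
  induction x using tensor_induction with
  | add x y hx hy => simp only [map_add, add_mul, mul_add, hx, hy]
  | tmul a b =>
    induction y using tensor_induction with
    | add x y hx hy => simp only [map_add, add_mul, mul_add, hx, hy]
    | tmul c d => simp [S_mul]

/-! ### Coproducts and counits on tensor powers -/

section

variable (B : Type v) [Ring B] [Algebra k B]

/-- `Δ ⊗ id : H ⊗ B → H ⊗ (H ⊗ B)`. -/
def comulFst : H ⊗[k] B →ₐ[k] H ⊗[k] (H ⊗[k] B) :=
  (Algebra.TensorProduct.assoc k k k H H B).toAlgHom.comp
    (Algebra.TensorProduct.map Q.comul (AlgHom.id k B))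

/-- `id ⊗ Δ : B ⊗ H → B ⊗ (H ⊗ H)`. -/
def comulSnd : B ⊗[k] H →ₐ[k] B ⊗[k] (H ⊗[k] H) :=
  Algebra.TensorProduct.map (AlgHom.id k B) Q.comul

/-- `ε ⊗ id : H ⊗ B → B`. -/
def counitFst : H ⊗[k] B →ₐ[k] B :=
  (Algebra.TensorProduct.lid k B).toAlgHom.comp
    (Algebra.TensorProduct.map Q.counit (AlgHom.id k B))

/-- `id ⊗ ε : B ⊗ H → B`. -/
def counitSnd : B ⊗[k] H →ₐ[k] B :=
  (Algebra.TensorProduct.rid k k B).toAlgHom.comp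
    (Algebra.TensorProduct.map (AlgHom.id k B) Q.counit)

variable {B} {C : Type v} [Ring C] [Algebra k C]

/-- `id ⊗ g : B ⊗ C → B ⊗ D` for an algebra morphism `g : C → D`. -/
def idTensor (B : Type v) [Ring B] [Algebra k B] {C D : Type v} [Ring C] [Algebra k C] [Ring D]
    [Algebra k D] (g : C →ₐ[k] D) : B ⊗[k] C →ₐ[k] B ⊗[k] D :=
  Algebra.TensorProduct.map (AlgHom.id k B) g

@[simp] theorem idTensor_tmul {D : Type v} [Ring D] [Algebra k D] (g : C →ₐ[k] D) (b : B) (c : C) :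
    idTensor B g (b ⊗ₜ c) = b ⊗ₜ[k] g c := rfl

/-- `x ↦ x ⊗ 1 : B ⊗ C → B ⊗ (C ⊗ H)`. -/
def tensorOne (B C H : Type v) [Ring B] [Algebra k B] [Ring C] [Algebra k C] [Ring H]
    [Algebra k H] : B ⊗[k] C →ₐ[k] B ⊗[k] (C ⊗[k] H) :=
  idTensor B Algebra.TensorProduct.includeLeft

@[simp] theorem tensorOne_tmul (b : B) (c : C) :
    tensorOne B C H (b ⊗ₜ[k] c) = b ⊗ₜ (c ⊗ₜ 1) := rfl

theorem comulFst_tmul (a : H) (b : B) : Q.comulFst B (a ⊗ₜ b) =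
    Algebra.TensorProduct.assoc k k k H H B (Q.comul a ⊗ₜ b) := rfl

@[simp] theorem comulSnd_tmul (b : B) (a : H) : Q.comulSnd B (b ⊗ₜ a) = b ⊗ₜ Q.comul a := rfl

@[simp] theorem counitFst_tmul (a : H) (b : B) : Q.counitFst B (a ⊗ₜ b) = Q.counit a • b := rfl

@[simp] theorem counitSnd_tmul (b : B) (a : H) : Q.counitSnd B (b ⊗ₜ a) = Q.counit a • b := rfl

@[simp] theorem counitFst_comul (a : H) : Q.counitFst H (Q.comul a) = a := Q.counit_left a

@[simp] theorem counitSnd_comul (a : H) : Q.counitSnd H (Q.comul a) = a := Q.counit_right a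

theorem coassoc (a : H) : Q.comulSnd H (Q.comul a) * Q.phi.val =
    Q.phi.val * Q.comulFst H (Q.comul a) := Q.quasi_coassoc a

@[simp] theorem phi_mul_inv : Q.phi.val * Q.phi.inv = 1 := Q.phi.val_inv

@[simp] theorem phi_inv_mul : Q.phi.inv * Q.phi.val = 1 := Q.phi.inv_val

theorem coassoc_inv (a : H) : Q.phi.inv * Q.comulSnd H (Q.comul a) =
    Q.comulFst H (Q.comul a) * Q.phi.inv := by
  have h := congrArg (fun x => Q.phi.inv * x * Q.phi.inv) (Q.coassoc a)
  simp only [← mul_assoc, phi_inv_mul, one_mul] at h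
  rw [← h, mul_assoc, phi_mul_inv, mul_one]

/-- The pentagon in terms of `comulFst`, `comulSnd`, `idTensor` and `tensorOne`. -/
theorem pentagon' :
    idTensor H (Q.comulSnd H) Q.phi.val * Q.comulFst (H ⊗[k] H) Q.phi.val =
      (1 : H) ⊗ₜ[k] Q.phi.val * idTensor H (Q.comulFst H) Q.phi.val *
        idTensor H (tensorOne H H H) Q.phi.val := Q.pentagon

theorem map_phi_mul_inv {A : Type*} [Ring A] [Algebra k A] (g : H ⊗[k] (H ⊗[k] H) →ₐ[k] A) :
    g Q.phi.val * g Q.phi.inv = 1 := by rw [← map_mul, phi_mul_inv, map_one]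

theorem map_phi_inv_mul {A : Type*} [Ring A] [Algebra k A] (g : H ⊗[k] (H ⊗[k] H) →ₐ[k] A) :
    g Q.phi.inv * g Q.phi.val = 1 := by rw [← map_mul, phi_inv_mul, map_one]

theorem one_tmul_phi_inv_mul :
    ((1 : H) ⊗ₜ[k] Q.phi.inv) * ((1 : H) ⊗ₜ[k] Q.phi.val) = 1 := by
  simp [Algebra.TensorProduct.one_def]

/-- `(id ⊗ ε ⊗ id)(φ) = 1`. -/
theorem counit_phi' : idTensor H (Q.counitFst H) Q.phi.val = 1 := Q.counit_phi

theorem counit_second_comulFst (w : H ⊗[k] B) :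
    idTensor H (Q.counitFst B) (Q.comulFst B w) = w := by
  induction w using tensor_induction with
  | add x y hx hy => simp only [map_add, hx, hy]
  | tmul a b =>
    have key : ∀ d : H ⊗[k] H, idTensor H (Q.counitFst B)
        (Algebra.TensorProduct.assoc k k k H H B (d ⊗ₜ b)) = Q.counitSnd H d ⊗ₜ b := by
      intro d
      induction d using tensor_induction with
      | add x y hx hy => simp only [map_add, TensorProduct.add_tmul, hx, hy]
      | tmul x y => simp [TensorProduct.smul_tmul]
    rw [comulFst_tmul, key, counitSnd_comul]

theorem counit_first_comulFst (w : H ⊗[k] B) :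
    Q.counitFst (H ⊗[k] B) (Q.comulFst B w) = w := by
  induction w using tensor_induction with
  | add x y hx hy => simp only [map_add, hx, hy]
  | tmul a b =>
    have key : ∀ d : H ⊗[k] H, Q.counitFst (H ⊗[k] B)
        (Algebra.TensorProduct.assoc k k k H H B (d ⊗ₜ b)) = Q.counitFst H d ⊗ₜ b := by
      intro d
      induction d using tensor_induction with
      | add x y hx hy => simp only [map_add, TensorProduct.add_tmul, hx, hy]
      | tmul x y => simp [TensorProduct.smul_tmul']
    rw [comulFst_tmul, key, counitFst_comul]

/-- `(ε ⊗ id ⊗ id)(φ) = 1`, by applying `ε` to the second slot of the pentagon. -/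
theorem counitFst_phi : Q.counitFst (H ⊗[k] H) Q.phi.val = 1 := by
  have h := congrArg (idTensor H (Q.counitFst (H ⊗[k] H))) Q.pentagon'
  have e3 : ∀ x : H ⊗[k] (H ⊗[k] H), idTensor H (Q.counitFst (H ⊗[k] H))
      (idTensor H (Q.comulSnd H) x) = Q.comulSnd H (idTensor H (Q.counitFst H) x) := by
    intro x
    induction x using tensor_induction₃ with
    | add x y hx hy => simp only [map_add, hx, hy]
    | tmul a b c => simp
  have e2 : ∀ x : H ⊗[k] (H ⊗[k] H), idTensor H (Q.counitFst (H ⊗[k] H))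
      (idTensor H (Q.comulFst H) x) = x := by
    intro x
    induction x using tensor_induction with
    | add x y hx hy => simp only [map_add, hx, hy]
    | tmul a w => simp [counit_first_comulFst]
  have e4 : ∀ x : H ⊗[k] (H ⊗[k] H), idTensor H (Q.counitFst (H ⊗[k] H))
      (idTensor H (tensorOne H H H) x) = tensorOne H H H (idTensor H (Q.counitFst H) x) := by
    intro x
    induction x using tensor_induction₃ with
    | add x y hx hy => simp only [map_add, hx, hy]
    | tmul a b c => simp [TensorProduct.tmul_smul]
  simp only [map_mul, e3, e2, e4, counit_second_comulFst, counit_phi', map_one, one_mul, mul_one,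
    idTensor_tmul] at h
  have h' : (1 : H) ⊗ₜ[k] Q.counitFst (H ⊗[k] H) Q.phi.val = 1 := by
    have := congrArg (· * Q.phi.inv) h
    simpa [mul_assoc] using this.symm
  have := congrArg (Q.counitFst (H ⊗[k] H)) h'
  simpa using this

/-- `(id ⊗ id ⊗ ε)(φ) = 1`, by applying `ε` to the third slot of the pentagon. -/
theorem counit_third_phi : idTensor H (Q.counitSnd H) Q.phi.val = 1 := by
  have h := congrArg (idTensor H (idTensor H (Q.counitFst H))) Q.pentagon'
  have e3 : ∀ x : H ⊗[k] (H ⊗[k] H), idTensor H (idTensor H (Q.counitFst H))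
      (idTensor H (Q.comulSnd H) x) = x := by
    intro x
    induction x using tensor_induction₃ with
    | add x y hx hy => simp only [map_add, hx, hy]
    | tmul a b c => simp
  have e2 : ∀ x : H ⊗[k] (H ⊗[k] H), idTensor H (idTensor H (Q.counitFst H))
      (idTensor H (Q.comulFst H) x) = x := by
    intro x
    induction x using tensor_induction with
    | add x y hx hy => simp only [map_add, hx, hy]
    | tmul a w => simp [counit_second_comulFst]
  have e1 : ∀ x : H ⊗[k] (H ⊗[k] H), idTensor H (idTensor H (Q.counitFst H))
      (Q.comulFst (H ⊗[k] H) x) = Q.comulFst H (idTensor H (Q.counitFst H) x) := by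
    intro x
    induction x using tensor_induction₃ with
    | add x y hx hy => simp only [map_add, hx, hy]
    | tmul a b c =>
      simp only [comulFst_tmul, idTensor_tmul, counitFst_tmul]
      generalize Q.comul a = d
      induction d using tensor_induction with
      | add x y hx hy => simp only [map_add, TensorProduct.add_tmul, hx, hy]
      | tmul x y => simp
  have e4 : ∀ x : H ⊗[k] (H ⊗[k] H), idTensor H (idTensor H (Q.counitFst H))
      (idTensor H (tensorOne H H H) x) = tensorOne H H H (idTensor H (Q.counitSnd H) x) := by
    intro x
    induction x using tensor_induction₃ with
    | add x y hx hy => simp only [map_add, hx, hy]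
    | tmul a b c => simp [TensorProduct.tmul_smul]
  simp only [map_mul, e3, e2, e1, e4, counit_phi', map_one, one_mul, mul_one,
    idTensor_tmul, ← Algebra.TensorProduct.one_def] at h
  have h' : tensorOne H H H (idTensor H (Q.counitSnd H) Q.phi.val) = 1 := by
    have := congrArg (Q.phi.inv * ·) h
    simpa [← mul_assoc] using this.symm
  have := congrArg (idTensor H (Q.counitSnd H)) h'
  have e5 : ∀ x : H ⊗[k] H, idTensor H (Q.counitSnd H) (tensorOne H H H x) = x := by
    intro x
    induction x using tensor_induction with
    | add x y hx hy => simp only [map_add, hx, hy]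
    | tmul a w => simp
  simpa [e5] using this

theorem map_phi_inv_eq_one {A : Type*} [Ring A] [Algebra k A] (g : H ⊗[k] (H ⊗[k] H) →ₐ[k] A)
    (hg : g Q.phi.val = 1) : g Q.phi.inv = 1 := by
  simpa [hg] using Q.map_phi_mul_inv g

end

/-! ### Contractions with `α` and `β` -/

/-- `x ⊗ y ↦ S(x) α y`. -/
def contractAlpha : H ⊗[k] H →ₗ[k] H := sandwich Q.S.toLinearMap LinearMap.id Q.alpha

/-- `x ⊗ y ↦ x β S(y)`. -/
def contractBeta : H ⊗[k] H →ₗ[k] H := sandwich LinearMap.id Q.S.toLinearMap Q.beta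

/-- `x ⊗ y ⊗ z ↦ x β S(y) α z`. -/
def zigzag : H ⊗[k] (H ⊗[k] H) →ₗ[k] H := sandwich LinearMap.id Q.contractAlpha Q.beta

/-- `x ⊗ y ⊗ z ↦ S(x) α y β S(z)`. -/
def zigzagInv : H ⊗[k] (H ⊗[k] H) →ₗ[k] H := sandwich Q.S.toLinearMap Q.contractBeta Q.alpha

@[simp] theorem contractAlpha_tmul (a b : H) : Q.contractAlpha (a ⊗ₜ b) = Q.S a * Q.alpha * b := rfl

@[simp] theorem contractBeta_tmul (a b : H) : Q.contractBeta (a ⊗ₜ b) = a * Q.beta * Q.S b := rfl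

theorem zigzag_tmul (a : H) (w : H ⊗[k] H) :
    Q.zigzag (a ⊗ₜ w) = a * Q.beta * Q.contractAlpha w := rfl

theorem zigzagInv_tmul (a : H) (w : H ⊗[k] H) :
    Q.zigzagInv (a ⊗ₜ w) = Q.S a * Q.alpha * Q.contractBeta w := rfl

theorem contractAlpha_comul (a : H) : Q.contractAlpha (Q.comul a) = Q.counit a • Q.alpha :=
  Q.antipode_alpha a

theorem contractBeta_comul (a : H) : Q.contractBeta (Q.comul a) = Q.counit a • Q.beta :=
  Q.antipode_beta a

theorem zigzag_phi : Q.zigzag Q.phi.val = 1 := Q.antipode_phi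

theorem zigzagInv_phi_inv : Q.zigzagInv Q.phi.inv = 1 := Q.antipode_phi_inv

theorem contractAlpha_tmul_mul (a b : H) (w : H ⊗[k] H) :
    Q.contractAlpha (w * (a ⊗ₜ b)) = Q.S a * Q.contractAlpha w * b := by
  induction w using tensor_induction with
  | add x y hx hy => simp only [map_add, add_mul, mul_add, hx, hy]
  | tmul c d => simp [S_mul, mul_assoc]

theorem contractBeta_tmul_mul (a b : H) (w : H ⊗[k] H) :
    Q.contractBeta ((a ⊗ₜ b) * w) = a * Q.contractBeta w * Q.S b := by
  induction w using tensor_induction with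
  | add x y hx hy => simp only [map_add, add_mul, mul_add, hx, hy]
  | tmul c d => simp [S_mul, mul_assoc]

theorem contractAlpha_comul_mul (a : H) (w : H ⊗[k] H) :
    Q.contractAlpha (Q.comul a * w) = Q.counit a • Q.contractAlpha w := by
  induction w using tensor_induction with
  | add x y hx hy => simp only [map_add, mul_add, hx, hy, smul_add]
  | tmul c d => simp [contractAlpha_tmul_mul, contractAlpha_comul]

theorem contractBeta_mul_comul (a : H) (w : H ⊗[k] H) :
    Q.contractBeta (w * Q.comul a) = Q.counit a • Q.contractBeta w := by
  induction w using tensor_induction with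
  | add x y hx hy => simp only [map_add, add_mul, hx, hy, smul_add]
  | tmul c d => simp [contractBeta_tmul_mul, contractBeta_comul]

theorem zigzag_mul_comulFst (y w) :
    Q.zigzag (y * Q.comulFst H w) = Q.zigzag y * Q.counitFst H w := by
  induction w using tensor_induction with
  | add x y hx hy => simp only [map_add, mul_add, hx, hy]
  | tmul a b =>
    induction y using tensor_induction₃ with
    | add x y hx hy => simp only [map_add, add_mul, hx, hy]
    | tmul y₁ y₂ y₃ =>
      have key : ∀ d : H ⊗[k] H, Q.zigzag ((y₁ ⊗ₜ (y₂ ⊗ₜ y₃)) *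
          Algebra.TensorProduct.assoc k k k H H H (d ⊗ₜ b)) =
          y₁ * Q.contractBeta d * (Q.S y₂ * Q.alpha * y₃ * b) := by
        intro d
        induction d using tensor_induction with
        | add x y hx hy => simp only [map_add, TensorProduct.add_tmul, mul_add, add_mul, hx, hy]
        | tmul x y => simp [zigzag_tmul, S_mul, mul_assoc]
      rw [comulFst_tmul, key, contractBeta_comul]
      simp [zigzag_tmul, mul_assoc]

theorem zigzag_comulSnd_mul (y w) :
    Q.zigzag (Q.comulSnd H w * y) = Q.counitSnd H w * Q.zigzag y := by
  induction w using tensor_induction with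
  | add x y hx hy => simp only [map_add, add_mul, hx, hy]
  | tmul a b =>
    induction y using tensor_induction with
    | add x y hx hy => simp only [map_add, mul_add, hx, hy]
    | tmul y₁ y' => simp [zigzag_tmul, contractAlpha_comul_mul, mul_assoc]

theorem zigzagInv_comulFst_mul (y w) :
    Q.zigzagInv (Q.comulFst H w * y) = Q.zigzagInv y * Q.S (Q.counitFst H w) := by
  induction w using tensor_induction with
  | add x y hx hy => simp only [map_add, add_mul, mul_add, hx, hy]
  | tmul a b =>
    induction y using tensor_induction₃ with
    | add x y hx hy => simp only [map_add, add_mul, mul_add, hx, hy]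
    | tmul y₁ y₂ y₃ =>
      have key : ∀ d : H ⊗[k] H, Q.zigzagInv (
          Algebra.TensorProduct.assoc k k k H H H (d ⊗ₜ b) * (y₁ ⊗ₜ (y₂ ⊗ₜ y₃))) =
          Q.S y₁ * Q.contractAlpha d * (y₂ * Q.beta * Q.S y₃ * Q.S b) := by
        intro d
        induction d using tensor_induction with
        | add x y hx hy => simp only [map_add, TensorProduct.add_tmul, mul_add, add_mul, hx, hy]
        | tmul x y => simp [zigzagInv_tmul, S_mul, mul_assoc]
      rw [comulFst_tmul, key, contractAlpha_comul]
      simp [zigzagInv_tmul, mul_assoc]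

theorem zigzagInv_mul_comulSnd (y w) :
    Q.zigzagInv (y * Q.comulSnd H w) = Q.S (Q.counitSnd H w) * Q.zigzagInv y := by
  induction w using tensor_induction with
  | add x y hx hy => simp only [map_add, add_mul, mul_add, hx, hy]
  | tmul a b =>
    induction y using tensor_induction with
    | add x y hx hy => simp only [map_add, mul_add, add_mul, hx, hy]
    | tmul y₁ y' => simp [zigzagInv_tmul, contractBeta_mul_comul, S_mul, mul_assoc]

/-! ### Consequences of the pentagon -/

/-- `(Δ ⊗ id ⊗ id)(φ) (φ⁻¹ ⊗ 1) = (id ⊗ id ⊗ Δ)(φ⁻¹) (1 ⊗ φ) (id ⊗ Δ ⊗ id)(φ)`. -/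
theorem pentagon_comulFst_mul_phi_inv :
    Q.comulFst (H ⊗[k] H) Q.phi.val * idTensor H (tensorOne H H H) Q.phi.inv =
      idTensor H (Q.comulSnd H) Q.phi.inv *
        ((1 : H) ⊗ₜ[k] Q.phi.val * idTensor H (Q.comulFst H) Q.phi.val) := by
  have h := congrArg (fun x => idTensor H (Q.comulSnd H) Q.phi.inv * x *
    idTensor H (tensorOne H H H) Q.phi.inv) Q.pentagon'
  simpa only [mul_assoc, map_phi_mul_inv, mul_one, ← mul_assoc (idTensor H (Q.comulSnd H) Q.phi.inv)
    (idTensor H (Q.comulSnd H) Q.phi.val), map_phi_inv_mul, one_mul] using h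

/-- `(φ ⊗ 1) (Δ ⊗ id ⊗ id)(φ⁻¹) = (id ⊗ Δ ⊗ id)(φ⁻¹) (1 ⊗ φ⁻¹) (id ⊗ id ⊗ Δ)(φ)`. -/
theorem pentagon_phi_mul_comulFst_inv :
    idTensor H (tensorOne H H H) Q.phi.val * Q.comulFst (H ⊗[k] H) Q.phi.inv =
      idTensor H (Q.comulFst H) Q.phi.inv * ((1 : H) ⊗ₜ[k] Q.phi.inv) *
        idTensor H (Q.comulSnd H) Q.phi.val := by
  have h := congrArg (fun x => idTensor H (Q.comulFst H) Q.phi.inv * ((1 : H) ⊗ₜ[k] Q.phi.inv) * x *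
    Q.comulFst (H ⊗[k] H) Q.phi.inv) Q.pentagon'
  have e : ∀ x, (1 : H) ⊗ₜ[k] Q.phi.inv * (((1 : H) ⊗ₜ[k] Q.phi.val) * x) = x := fun x => by
    rw [← mul_assoc, one_tmul_phi_inv_mul, one_mul]
  have e' : ∀ x, idTensor H (Q.comulFst H) Q.phi.inv *
      (idTensor H (Q.comulFst H) Q.phi.val * x) = x := fun x => by
    rw [← mul_assoc, map_phi_inv_mul, one_mul]
  simp only [mul_assoc, map_phi_mul_inv, mul_one, e, e'] at h
  rw [← h, mul_assoc]

/-- `X₁ x̄ ⊗ X₂ ȳ β S(Y z̄) α Z = 1 ⊗ 1`, where `φ = X ⊗ Y ⊗ Z` and `φ⁻¹ = x̄ ⊗ ȳ ⊗ z̄`. -/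
theorem lTensor_zigzag_comulFst :
    LinearMap.lTensor H Q.zigzag (Q.comulFst (H ⊗[k] H) Q.phi.val *
      idTensor H (tensorOne H H H) Q.phi.inv) = 1 := by
  have e3 : ∀ x y, LinearMap.lTensor H Q.zigzag (idTensor H (Q.comulSnd H) x * y) =
      idTensor H (Q.counitSnd H) x * LinearMap.lTensor H Q.zigzag y := by
    intro x y
    induction x using tensor_induction with
    | add x y hx hy => simp only [map_add, add_mul, hx, hy]
    | tmul a w =>
      induction y using tensor_induction with
      | add x y hx hy => simp only [map_add, mul_add, hx, hy]
      | tmul b w' => simp [zigzag_comulSnd_mul]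
  have e2 : ∀ x y, LinearMap.lTensor H Q.zigzag (y * idTensor H (Q.comulFst H) x) =
      LinearMap.lTensor H Q.zigzag y * idTensor H (Q.counitFst H) x := by
    intro x y
    induction x using tensor_induction with
    | add x y hx hy => simp only [map_add, mul_add, hx, hy]
    | tmul a w =>
      induction y using tensor_induction with
      | add x y hx hy => simp only [map_add, add_mul, hx, hy]
      | tmul b w' => simp [zigzag_mul_comulFst]
  rw [pentagon_comulFst_mul_phi_inv, e3, e2, counit_phi',
    Q.map_phi_inv_eq_one _ Q.counit_third_phi, LinearMap.lTensor_tmul, zigzag_phi]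
  simp [Algebra.TensorProduct.one_def]

/-- `X x̄₁ ⊗ S(Y x̄₂) α Z ȳ β S(z̄) = 1 ⊗ 1`, where `φ = X ⊗ Y ⊗ Z` and `φ⁻¹ = x̄ ⊗ ȳ ⊗ z̄`. -/
theorem lTensor_zigzagInv_comulFst :
    LinearMap.lTensor H Q.zigzagInv (idTensor H (tensorOne H H H) Q.phi.val *
      Q.comulFst (H ⊗[k] H) Q.phi.inv) = 1 := by
  have e3 : ∀ x y, LinearMap.lTensor H Q.zigzagInv (y * idTensor H (Q.comulSnd H) x) =
      sandwich (Algebra.TensorProduct.includeRight.toLinearMap ∘ₗ Q.S.toLinearMap)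
        Algebra.TensorProduct.includeLeft.toLinearMap (LinearMap.lTensor H Q.zigzagInv y)
        (flip (idTensor H (Q.counitSnd H) x)) := by
    intro x y
    induction x using tensor_induction with
    | add x y hx hy => simp only [map_add, mul_add, hx, hy]
    | tmul a w =>
      induction y using tensor_induction with
      | add x y hx hy => simp only [map_add, add_mul, hx, hy, sandwich_add]
      | tmul d w' => simp [zigzagInv_mul_comulSnd, flip]
  have e2 : ∀ x y, LinearMap.lTensor H Q.zigzagInv (idTensor H (Q.comulFst H) x * y) =
      sandwich Algebra.TensorProduct.includeLeft.toLinearMap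
        (Algebra.TensorProduct.includeRight.toLinearMap ∘ₗ Q.S.toLinearMap)
        (LinearMap.lTensor H Q.zigzagInv y) (idTensor H (Q.counitFst H) x) := by
    intro x y
    induction x using tensor_induction with
    | add x y hx hy => simp only [map_add, add_mul, hx, hy]
    | tmul a w =>
      induction y using tensor_induction with
      | add x y hx hy => simp only [map_add, mul_add, hx, hy, sandwich_add]
      | tmul b w' => simp [zigzagInv_comulFst_mul]
  rw [pentagon_phi_mul_comulFst_inv, e3, counit_third_phi, e2,
    Q.map_phi_inv_eq_one _ Q.counit_phi', LinearMap.lTensor_tmul, zigzagInv_phi_inv]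
  simp [Algebra.TensorProduct.one_def, flip]

/-! ### The elements `p_R` and `q_R` -/

/-- `x ↦ x ⊗ 1`. -/
abbrev inl : H →ₐ[k] H ⊗[k] H := Algebra.TensorProduct.includeLeft

/-- `x ↦ 1 ⊗ x`. -/
abbrev inr : H →ₐ[k] H ⊗[k] H := Algebra.TensorProduct.includeRight

/-- `q' = (S ⊗ S)(q_R²¹)`. -/
def qTwist : H ⊗[k] H := Q.flipS Q.qR

theorem pR_eq : Q.pR = LinearMap.lTensor H Q.contractBeta Q.phi.inv := rfl

/-- `q' = S(Y) α Z ⊗ S(X)`, where `φ = X ⊗ Y ⊗ Z`. -/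
theorem qTwist_eq :
    Q.qTwist = flip (TensorProduct.map Q.S.toLinearMap Q.contractAlpha Q.phi.val) := by
  rw [qTwist, qR]
  induction Q.phi.val using tensor_induction₃ with
  | add x y hx hy => simp only [map_add, hx, hy]
  | tmul a b c => simp [flip, S_mul, mul_assoc]

/-- `Δ(a₁) p_R (1 ⊗ S(a₂)) = p_R (a ⊗ 1)`. -/
theorem sandwich_pR (a : H) :
    sandwich Q.comul.toLinearMap (inr.toLinearMap ∘ₗ Q.S.toLinearMap) Q.pR (Q.comul a) =
      Q.pR * (a ⊗ₜ 1) := by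
  have e1 : ∀ w x, LinearMap.lTensor H Q.contractBeta (Q.comulFst H w * x) =
      sandwich Q.comul.toLinearMap (inr.toLinearMap ∘ₗ Q.S.toLinearMap)
        (LinearMap.lTensor H Q.contractBeta x) w := by
    intro w x
    induction w using tensor_induction with
    | add x y hx hy => simp only [map_add, add_mul, hx, hy]
    | tmul b c =>
      induction x using tensor_induction₃ with
      | add x y hx hy => simp only [map_add, mul_add, hx, hy, sandwich_add]
      | tmul x₁ x₂ x₃ =>
        rw [comulFst_tmul, sandwich_tmul, AlgHom.toLinearMap_apply]
        induction Q.comul b using tensor_induction with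
        | add x y hx hy => simp only [map_add, TensorProduct.add_tmul, add_mul, hx, hy]
        | tmul d₁ d₂ => simp [S_mul, mul_assoc]
  have e2 : ∀ w x, LinearMap.lTensor H Q.contractBeta (x * Q.comulSnd H w) =
      LinearMap.lTensor H Q.contractBeta x * (Q.counitSnd H w ⊗ₜ 1) := by
    intro w x
    induction w using tensor_induction with
    | add x y hx hy => simp only [map_add, mul_add, TensorProduct.add_tmul, hx, hy]
    | tmul b c =>
      induction x using tensor_induction with
      | add x y hx hy => simp only [map_add, add_mul, hx, hy]
      | tmul x₁ x' => simp [contractBeta_mul_comul, TensorProduct.smul_tmul]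
  rw [pR_eq, ← e1, ← coassoc_inv, e2, counitSnd_comul]

/-- `σ(Δ(b₁)) q' (b₂ ⊗ 1) = q' (1 ⊗ S(b))`. -/
theorem sandwich_qTwist (b : H) :
    sandwich (Q.flipS.toLinearMap ∘ₗ Q.comul.toLinearMap) inl.toLinearMap Q.qTwist (Q.comul b) =
      Q.qTwist * (1 ⊗ₜ Q.S b) := by
  have e1 : ∀ w x, flip (TensorProduct.map Q.S.toLinearMap Q.contractAlpha (x * Q.comulFst H w)) =
      sandwich (Q.flipS.toLinearMap ∘ₗ Q.comul.toLinearMap) inl.toLinearMap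
        (flip (TensorProduct.map Q.S.toLinearMap Q.contractAlpha x)) w := by
    intro w x
    induction w using tensor_induction with
    | add x y hx hy => simp only [map_add, mul_add, hx, hy]
    | tmul b c =>
      induction x using tensor_induction₃ with
      | add x y hx hy => simp only [map_add, add_mul, hx, hy, sandwich_add]
      | tmul x₁ x₂ x₃ =>
        rw [comulFst_tmul, sandwich_tmul, LinearMap.comp_apply, AlgHom.toLinearMap_apply]
        induction Q.comul b using tensor_induction with
        | add x y hx hy => simp only [map_add, TensorProduct.add_tmul, mul_add, add_mul, hx, hy]
        | tmul d₁ d₂ => simp [S_mul, mul_assoc, flip]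
  have e2 : ∀ w x, flip (TensorProduct.map Q.S.toLinearMap Q.contractAlpha (Q.comulSnd H w * x)) =
      flip (TensorProduct.map Q.S.toLinearMap Q.contractAlpha x) *
        (1 ⊗ₜ Q.S (Q.counitSnd H w)) := by
    intro w x
    induction w using tensor_induction with
    | add x y hx hy => simp only [map_add, add_mul, mul_add, TensorProduct.tmul_add, hx, hy]
    | tmul b c =>
      induction x using tensor_induction with
      | add x y hx hy => simp only [map_add, mul_add, add_mul, hx, hy]
      | tmul x₁ x' => simp [contractAlpha_comul_mul, S_mul, flip, TensorProduct.smul_tmul']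
  rw [qTwist_eq, ← e1, ← coassoc, e2, counitSnd_comul]

/-! ### The element `γ` -/

/-- The inverse reassociation `H ⊗ (H ⊗ B) → (H ⊗ H) ⊗ B`. -/
def assocInv (B : Type v) [Ring B] [Algebra k B] : H ⊗[k] (H ⊗[k] B) →ₐ[k] (H ⊗[k] H) ⊗[k] B :=
  (Algebra.TensorProduct.assoc k k k H H B).symm.toAlgHom

@[simp] theorem assocInv_tmul {B : Type v} [Ring B] [Algebra k B] (a b : H) (c : B) :
    assocInv B (a ⊗ₜ[k] (b ⊗ₜ[k] c)) = (a ⊗ₜ b) ⊗ₜ c := rfl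

@[simp] theorem assocInv_assoc {B : Type v} [Ring B] [Algebra k B] (x : (H ⊗[k] H) ⊗[k] B) :
    assocInv B (Algebra.TensorProduct.assoc k k k H H B x) = x :=
  (Algebra.TensorProduct.assoc k k k H H B).symm_apply_apply x

/-- `t ⊗ u ⊗ v ⊗ w ↦ S(u) α v ⊗ S(t) α w`. -/
def doubleAlpha : H ⊗[k] (H ⊗[k] (H ⊗[k] H)) →ₗ[k] H ⊗[k] H :=
  sandwich Q.flipS.toLinearMap LinearMap.id (Q.alpha ⊗ₜ Q.alpha) ∘ₗ
    (assocInv (H ⊗[k] H)).toLinearMap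

theorem gamma_eq : Q.gamma = Q.doubleAlpha Q.tensorTUVW := rfl

theorem tensorTUVW_eq : Q.tensorTUVW =
    ((1 : H) ⊗ₜ[k] Q.phi.inv) * idTensor H (Q.comulSnd H) Q.phi.val := rfl

theorem doubleAlpha_mul (x y) : Q.doubleAlpha (x * y) =
    sandwich Q.flipS.toLinearMap LinearMap.id (Q.doubleAlpha x) (assocInv _ y) := by
  rw [doubleAlpha, LinearMap.comp_apply, AlgHom.toLinearMap_apply, map_mul, sandwich_mul_right]
  · rfl
  · exact Q.flipS_mul
  · intro x y; rfl

/-- The contraction `S(u) α v` kills the coproduct in the middle slots. -/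
theorem doubleAlpha_comulFst (x) : Q.doubleAlpha (idTensor H (Q.comulFst H) x) =
    Q.alpha ⊗ₜ Q.contractAlpha (idTensor H (Q.counitFst H) x) := by
  induction x using tensor_induction₃ with
  | add x y hx hy => simp only [map_add, hx, hy, TensorProduct.tmul_add]
  | tmul a b c =>
    have key : ∀ d : H ⊗[k] H, Q.doubleAlpha (a ⊗ₜ
        Algebra.TensorProduct.assoc k k k H H H (d ⊗ₜ c)) =
        Q.contractAlpha d ⊗ₜ (Q.S a * Q.alpha * c) := by
      intro d
      induction d using tensor_induction with
      | add x y hx hy => simp only [map_add, TensorProduct.add_tmul, TensorProduct.tmul_add, hx, hy]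
      | tmul x y => simp [doubleAlpha]
    rw [idTensor_tmul, comulFst_tmul, key, contractAlpha_comul]
    simp [TensorProduct.smul_tmul']

/-- The pentagon, with `1 ⊗ φ` moved to the left-hand side. -/
theorem tensorTUVW_mul_comulFst : Q.tensorTUVW * Q.comulFst (H ⊗[k] H) Q.phi.val =
    idTensor H (Q.comulFst H) Q.phi.val * idTensor H (tensorOne H H H) Q.phi.val := by
  rw [tensorTUVW_eq, mul_assoc, pentagon', ← mul_assoc, ← mul_assoc, one_tmul_phi_inv_mul, one_mul]

theorem tensorTUVW_mul_comul (a : H) :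
    Q.tensorTUVW * idTensor H (Q.comulSnd H) (Q.comulFst H (Q.comul a)) =
      idTensor H (Q.comulFst H) (Q.comulSnd H (Q.comul a)) * Q.tensorTUVW := by
  have e : ∀ w : H ⊗[k] H, ((1 : H) ⊗ₜ[k] Q.phi.inv) * idTensor H (Q.comulSnd H) (Q.comulSnd H w) =
      idTensor H (Q.comulFst H) (Q.comulSnd H w) * ((1 : H) ⊗ₜ[k] Q.phi.inv) := by
    intro w
    induction w using tensor_induction with
    | add x y hx hy => simp only [map_add, add_mul, mul_add, hx, hy]
    | tmul b c =>
      simp only [idTensor_tmul, comulSnd_tmul, Algebra.TensorProduct.tmul_mul_tmul, one_mul,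
        mul_one, coassoc_inv]
  rw [tensorTUVW_eq, mul_assoc, ← map_mul, ← coassoc, map_mul, ← mul_assoc, e, mul_assoc]

/-- `σ(Δ(a)) γ Δ(b)` as a function of `a ⊗ b`. -/
def gammaOrbit : H ⊗[k] H →ₗ[k] H ⊗[k] H :=
  sandwich (Q.flipS.toLinearMap ∘ₗ Q.comul.toLinearMap) Q.comul.toLinearMap Q.gamma

theorem gammaOrbit_tmul (a b : H) :
    Q.gammaOrbit (a ⊗ₜ b) = Q.flipS (Q.comul a) * Q.gamma * Q.comul b := rfl

theorem f_eq : Q.f = Q.gammaOrbit Q.pR := by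
  rw [f, pR, gammaOrbit, sandwich]
  induction Q.phi.inv using tensor_induction with
  | add x y hx hy => simp only [map_add, hx, hy]
  | tmul a w => rfl

/-- `σ(Δ(a₁)) γ Δ(a₂) = ε(a) γ`. -/
theorem gammaOrbit_comul (a : H) : Q.gammaOrbit (Q.comul a) = Q.counit a • Q.gamma := by
  have e1 : ∀ w r, sandwich (Q.flipS.toLinearMap ∘ₗ Q.comul.toLinearMap) Q.comul.toLinearMap r w =
      sandwich Q.flipS.toLinearMap LinearMap.id r
        (assocInv (H ⊗[k] H) (idTensor H (Q.comulSnd H) (Q.comulFst H w))) := by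
    intro w r
    induction w using tensor_induction with
    | add x y hx hy => simp only [map_add, hx, hy]
    | tmul b c =>
      rw [comulFst_tmul, sandwich_tmul, LinearMap.comp_apply, AlgHom.toLinearMap_apply]
      induction Q.comul b using tensor_induction with
      | add x y hx hy => simp only [map_add, TensorProduct.add_tmul, add_mul, hx, hy]
      | tmul d₁ d₂ => simp
  have e2 : ∀ w, idTensor H (Q.counitFst H) (Q.comulSnd H w) = w := by
    intro w
    induction w using tensor_induction with
    | add x y hx hy => simp only [map_add, hx, hy]
    | tmul b c => simp
  rw [gammaOrbit, e1, gamma_eq, ← doubleAlpha_mul, tensorTUVW_mul_comul, doubleAlpha_mul,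
    doubleAlpha_comulFst, e2, contractAlpha_comul, TensorProduct.tmul_smul, sandwich_smul]
  rfl

theorem gammaOrbit_comul_mul (a : H) (w) :
    Q.gammaOrbit (Q.comul a * w) = Q.counit a • Q.gammaOrbit w := by
  rw [gammaOrbit, sandwich_mul_right, ← gammaOrbit, gammaOrbit_comul, sandwich_smul]
  · rfl
  · intro x y; simp [flipS_mul]
  · intro x y; simp

theorem gammaOrbit_mul_comul (w) (b : H) :
    Q.gammaOrbit w * Q.comul b = Q.gammaOrbit (w * (1 ⊗ₜ b)) := by
  induction w using tensor_induction with
  | add x y hx hy => simp only [map_add, add_mul, hx, hy]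
  | tmul c d => simp [gammaOrbit_tmul, mul_assoc]

theorem flipS_comul_mul_gammaOrbit (w) (a : H) :
    Q.flipS (Q.comul a) * Q.gammaOrbit w = Q.gammaOrbit (w * (a ⊗ₜ 1)) := by
  induction w using tensor_induction with
  | add x y hx hy => simp only [map_add, add_mul, mul_add, hx, hy]
  | tmul c d => simp [gammaOrbit_tmul, mul_assoc, flipS_mul]

/-! ### Drinfeld's twist -/

/-- `f Δ(S(a)) = σ(Δ(a)) f`: the twist intertwines `Δ ∘ S` with `(S ⊗ S) ∘ Δᵒᵖ`. -/
theorem f_mul_comul_S (a : H) : Q.f * Q.comul (Q.S a) = Q.flipS (Q.comul a) * Q.f := by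
  have e : ∀ w, Q.gammaOrbit (sandwich Q.comul.toLinearMap (inr.toLinearMap ∘ₗ Q.S.toLinearMap)
      Q.pR w) = Q.gammaOrbit (Q.pR * (1 ⊗ₜ Q.S (Q.counitFst H w))) := by
    intro w
    induction w using tensor_induction with
    | add x y hx hy => simp only [map_add, mul_add, TensorProduct.tmul_add, hx, hy]
    | tmul b c => simp [mul_assoc, gammaOrbit_comul_mul]
  rw [f_eq, flipS_comul_mul_gammaOrbit, ← sandwich_pR, e, counitFst_comul, gammaOrbit_mul_comul]

/-- `f Δ(α) = γ`. -/
theorem f_mul_comul_alpha : Q.f * Q.comul Q.alpha = Q.gamma := by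
  have e1 : ∀ x, LinearMap.lTensor H Q.contractBeta x * (1 ⊗ₜ Q.alpha) =
      LinearMap.lTensor H Q.zigzag (idTensor H (tensorOne H H H) x) := by
    intro x
    induction x using tensor_induction₃ with
    | add x y hx hy => simp only [map_add, add_mul, hx, hy]
    | tmul a b c => simp [zigzag_tmul, mul_assoc]
  have e2 : ∀ x y, Q.gammaOrbit (LinearMap.lTensor H Q.zigzag (Q.comulFst (H ⊗[k] H) x * y)) =
      Q.gammaOrbit (LinearMap.lTensor H Q.zigzag
        (((1 : H) ⊗ₜ ((1 : H) ⊗ₜ Q.counitFst (H ⊗[k] H) x)) * y)) := by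
    intro x y
    induction x using tensor_induction with
    | add x y hx hy => simp only [map_add, add_mul, TensorProduct.tmul_add, hx, hy]
    | tmul a w =>
      induction y using tensor_induction₃ with
      | add x y hx hy => simp only [map_add, mul_add, hx, hy]
      | tmul y₁ y₂ y' =>
        have key : ∀ d : H ⊗[k] H, LinearMap.lTensor H Q.zigzag
            (Algebra.TensorProduct.assoc k k k H H (H ⊗[k] H) (d ⊗ₜ w) * (y₁ ⊗ₜ (y₂ ⊗ₜ y'))) =
            d * (y₁ ⊗ₜ Q.zigzag (y₂ ⊗ₜ (w * y'))) := by
          intro d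
          induction d using tensor_induction with
          | add x y hx hy => simp only [map_add, TensorProduct.add_tmul, add_mul, hx, hy]
          | tmul x y => simp [zigzag_tmul, mul_assoc]
        rw [comulFst_tmul, key, gammaOrbit_comul_mul]
        simp
  have e3 : Q.comulFst (H ⊗[k] H) Q.phi.inv * (Q.comulFst (H ⊗[k] H) Q.phi.val *
      idTensor H (tensorOne H H H) Q.phi.inv) = idTensor H (tensorOne H H H) Q.phi.inv := by
    rw [← mul_assoc, map_phi_inv_mul, one_mul]
  rw [f_eq, gammaOrbit_mul_comul, pR_eq, e1, ← e3, e2, Q.map_phi_inv_eq_one _ Q.counitFst_phi,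
    ← Algebra.TensorProduct.one_def, ← Algebra.TensorProduct.one_def, one_mul,
    lTensor_zigzag_comulFst, Algebra.TensorProduct.one_def, gammaOrbit_tmul]
  simp

/-- `Δ(S(X) α) (Y ⊗ Z)`, where `φ = X ⊗ Y ⊗ Z`. -/
def phiEval : H ⊗[k] H :=
  sandwich (Q.comul.toLinearMap ∘ₗ Q.S.toLinearMap) LinearMap.id (Q.comul Q.alpha) Q.phi.val

/-- `f Δ(S(X) α) (Y ⊗ Z) = q' (1 ⊗ α)`: by the two relations above the left-hand side is
`σ(Δ(X)) γ (Y ⊗ Z)`, and the pentagon evaluates it. -/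
theorem f_mul_phiEval : Q.f * Q.phiEval = Q.qTwist * (1 ⊗ₜ Q.alpha) := by
  have e1 : ∀ x, Q.f * sandwich (Q.comul.toLinearMap ∘ₗ Q.S.toLinearMap) LinearMap.id
      (Q.comul Q.alpha) x =
      sandwich Q.flipS.toLinearMap LinearMap.id Q.gamma (assocInv _ (Q.comulFst (H ⊗[k] H) x)) := by
    intro x
    induction x using tensor_induction with
    | add x y hx hy => simp only [map_add, mul_add, hx, hy]
    | tmul a w =>
      simp [comulFst_tmul, ← f_mul_comul_alpha, ← mul_assoc, f_mul_comul_S]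
  have e2 : ∀ x, sandwich Q.flipS.toLinearMap LinearMap.id (Q.alpha ⊗ₜ Q.alpha)
      (assocInv _ (idTensor H (tensorOne H H H) x)) =
      flip (TensorProduct.map Q.S.toLinearMap Q.contractAlpha x) * (1 ⊗ₜ Q.alpha) := by
    intro x
    induction x using tensor_induction₃ with
    | add x y hx hy => simp only [map_add, add_mul, hx, hy]
    | tmul a b c => simp [flip]
  rw [phiEval, e1, gamma_eq, ← doubleAlpha_mul, tensorTUVW_mul_comulFst, doubleAlpha_mul,
    doubleAlpha_comulFst, counit_phi', Algebra.TensorProduct.one_def, contractAlpha_tmul,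
    S_one, one_mul, mul_one, e2, qTwist_eq]

/-! ### Invertibility of the twist -/

theorem f_mul_sandwich {B : Type v} [AddCommGroup B] [Module k B] (g : B →ₗ[k] H ⊗[k] H) (r w) :
    Q.f * sandwich (Q.comul.toLinearMap ∘ₗ Q.S.toLinearMap) g r w =
      sandwich (Q.flipS.toLinearMap ∘ₗ Q.comul.toLinearMap) g (Q.f * r) w := by
  induction w using tensor_induction with
  | add x y hx hy => simp only [map_add, mul_add, hx, hy]
  | tmul a w => simp [← mul_assoc, f_mul_comul_S]

theorem sandwich_inl_mul_inr {A : Type v} [AddCommGroup A] [Module k A] (g : A →ₗ[k] H ⊗[k] H)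
    (r w) (c : H) : sandwich g inl.toLinearMap (r * (1 ⊗ₜ c)) w =
      sandwich g inl.toLinearMap r w * ((1 : H) ⊗ₜ[k] c) := by
  induction w using tensor_induction with
  | add x y hx hy => simp only [map_add, add_mul, hx, hy]
  | tmul a w => simp [mul_assoc]

/-- The element `Δ(S(x̄₁)) K (x̄₂ ⊗ ȳ β S(z̄))`, with `K = Δ(S(X) α) (Y ⊗ Z)`; it satisfies
`f u = q'`. -/
def preU : H ⊗[k] H :=
  LinearMap.mul' k (H ⊗[k] H) (TensorProduct.map
    (sandwich (Q.comul.toLinearMap ∘ₗ Q.S.toLinearMap) inl.toLinearMap Q.phiEval ∘ₗ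
      Q.comul.toLinearMap) (inr.toLinearMap ∘ₗ Q.contractBeta) Q.phi.inv)

/-- Moving `f` to the right through `Δ(S(x̄₁)) K (x̄₂ ⊗ 1)` leaves `q' (1 ⊗ S(x̄) α)`, and
`S(x̄) α ȳ β S(z̄) = 1`. -/
theorem f_mul_preU : Q.f * Q.preU = Q.qTwist := by
  have e : ∀ x, Q.f * LinearMap.mul' k (H ⊗[k] H) (TensorProduct.map
      (sandwich (Q.comul.toLinearMap ∘ₗ Q.S.toLinearMap) inl.toLinearMap Q.phiEval ∘ₗ
      Q.comul.toLinearMap) (inr.toLinearMap ∘ₗ Q.contractBeta) x) =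
      Q.qTwist * (1 ⊗ₜ Q.zigzagInv x) := by
    intro x
    induction x using tensor_induction with
    | add x y hx hy => simp only [map_add, mul_add, TensorProduct.tmul_add, hx, hy]
    | tmul a w =>
      rw [TensorProduct.map_tmul, LinearMap.mul'_apply, ← mul_assoc, LinearMap.comp_apply,
        f_mul_sandwich, f_mul_phiEval, sandwich_inl_mul_inr, AlgHom.toLinearMap_apply,
        sandwich_qTwist, zigzagInv_tmul]
      simp [mul_assoc]
  rw [preU, e, zigzagInv_phi_inv, ← Algebra.TensorProduct.one_def, mul_one]

/-- `σ(Δ(p¹)) q' (p² ⊗ 1) = 1`, where `p_R = p¹ ⊗ p²`. -/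
theorem sandwich_qTwist_pR :
    sandwich (Q.flipS.toLinearMap ∘ₗ Q.comul.toLinearMap) inl.toLinearMap Q.qTwist Q.pR = 1 := by
  have e : ∀ x y, sandwich (Q.flipS.toLinearMap ∘ₗ Q.comul.toLinearMap) inl.toLinearMap
      (flip (TensorProduct.map Q.S.toLinearMap Q.contractAlpha y))
      (LinearMap.lTensor H Q.contractBeta x) =
      flip (TensorProduct.map Q.S.toLinearMap LinearMap.id (LinearMap.lTensor H Q.zigzagInv
        (idTensor H (tensorOne H H H) y * Q.comulFst (H ⊗[k] H) x))) := by
    intro x y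
    induction x using tensor_induction₃ with
    | add x y hx hy => simp only [map_add, mul_add, hx, hy]
    | tmul a b c =>
      induction y using tensor_induction₃ with
      | add x y hx hy => simp only [map_add, add_mul, hx, hy, sandwich_add]
      | tmul y₁ y₂ y₃ =>
        rw [comulFst_tmul, LinearMap.lTensor_tmul, sandwich_tmul, LinearMap.comp_apply,
          AlgHom.toLinearMap_apply]
        induction Q.comul a using tensor_induction with
        | add x y hx hy => simp only [map_add, TensorProduct.add_tmul, mul_add, add_mul, hx, hy]
        | tmul d₁ d₂ => simp [S_mul, mul_assoc, flip, zigzagInv_tmul]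
  rw [qTwist_eq, pR_eq, e, lTensor_zigzagInv_comulFst]
  simp [Algebra.TensorProduct.one_def, flip]

/-- An explicit right inverse of the twist. -/
theorem f_mul_sandwich_preU :
    Q.f * sandwich (Q.comul.toLinearMap ∘ₗ Q.S.toLinearMap) inl.toLinearMap Q.preU Q.pR = 1 := by
  rw [f_mul_sandwich, f_mul_preU, sandwich_qTwist_pR]

section

variable [FiniteDimensional k H]

/-- Drinfeld: the twist `f` is invertible. -/
theorem isUnit_f : IsUnit Q.f := by
  have : IsNoetherianRing (H ⊗[k] H) := IsNoetherianRing.of_finite k _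
  -- A right inverse in a Noetherian ring is two-sided.
  exact IsUnit.of_mul_eq_one _ Q.f_mul_sandwich_preU

@[simp] theorem f_mul_fInv : Q.f * Q.fInv = 1 := Ring.mul_inverse_cancel _ Q.isUnit_f

@[simp] theorem fInv_mul_f : Q.fInv * Q.f = 1 := Ring.inverse_mul_cancel _ Q.isUnit_f

theorem f_mul_cancel {x y : H ⊗[k] H} (h : Q.f * x = Q.f * y) : x = y := by
  simpa [← mul_assoc] using congrArg (Q.fInv * ·) h

theorem f_mul_U : Q.f * Q.U = Q.qTwist := by
  rw [U, ← mul_assoc, f_mul_fInv, one_mul]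
  rfl

/-- `Δ(S(b₁)) U (b₂ ⊗ 1) = U (1 ⊗ S(b))`. -/
theorem sandwich_U (b : H) :
    sandwich (Q.comul.toLinearMap ∘ₗ Q.S.toLinearMap) inl.toLinearMap Q.U (Q.comul b) =
      Q.U * (1 ⊗ₜ Q.S b) := by
  apply Q.f_mul_cancel
  rw [f_mul_sandwich, ← mul_assoc, f_mul_U, sandwich_qTwist]

/-- `U (1 ⊗ α) = Δ(S(X) α) (Y ⊗ Z)`. -/
theorem U_mul_alpha : Q.U * (1 ⊗ₜ Q.alpha) = Q.phiEval := by
  apply Q.f_mul_cancel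
  rw [← mul_assoc, f_mul_U, f_mul_phiEval]

/-- `f⁻¹ = Δ(S(p¹)) U (p² ⊗ 1)`. -/
theorem fInv_eq :
    Q.fInv = sandwich (Q.comul.toLinearMap ∘ₗ Q.S.toLinearMap) inl.toLinearMap Q.U Q.pR := by
  apply Q.f_mul_cancel
  rw [f_mul_sandwich, f_mul_U, sandwich_qTwist_pR, f_mul_fInv]

end

/-! ### `p_R` in terms of `U` -/

/-- `x ⊗ y ⊗ z ↦ Δ(x β S(y)) U (z ⊗ 1)`. -/
def betaU : H ⊗[k] (H ⊗[k] H) →ₗ[k] H ⊗[k] H :=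
  sandwich (Q.comul.toLinearMap ∘ₗ Q.contractBeta) inl.toLinearMap Q.U ∘ₗ (assocInv H).toLinearMap

theorem betaU_tmul (a b c : H) : Q.betaU (a ⊗ₜ (b ⊗ₜ c)) =
    Q.comul (a * Q.beta * Q.S b) * Q.U * (c ⊗ₜ 1) := rfl

theorem betaU_mul_comulFst (x w) :
    Q.betaU (x * Q.comulFst H w) = Q.betaU x * (Q.counitFst H w ⊗ₜ 1) := by
  induction w using tensor_induction with
  | add x y hx hy => simp only [map_add, mul_add, TensorProduct.add_tmul, hx, hy]
  | tmul b c =>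
    induction x using tensor_induction₃ with
    | add x y hx hy => simp only [map_add, add_mul, hx, hy]
    | tmul x₁ x₂ x₃ =>
      have key : ∀ d : H ⊗[k] H, Q.betaU ((x₁ ⊗ₜ (x₂ ⊗ₜ x₃)) *
          Algebra.TensorProduct.assoc k k k H H H (d ⊗ₜ c)) =
          Q.comul (x₁ * Q.contractBeta d * Q.S x₂) * Q.U * ((x₃ * c) ⊗ₜ 1) := by
        intro d
        induction d using tensor_induction with
        | add x y hx hy => simp only [map_add, TensorProduct.add_tmul, mul_add, add_mul, hx, hy]
        | tmul x y => simp [betaU_tmul, S_mul, mul_assoc]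
      rw [comulFst_tmul, key, contractBeta_comul]
      simp [betaU_tmul, mul_assoc, ← TensorProduct.smul_tmul']

/-- `a ⊗ b ⊗ w ↦ Δ(a β S(b) α) w`. -/
def betaAlpha : H ⊗[k] (H ⊗[k] (H ⊗[k] H)) →ₗ[k] H ⊗[k] H :=
  sandwich (Q.comul.toLinearMap ∘ₗ LinearMap.mulRight k Q.alpha ∘ₗ Q.contractBeta) LinearMap.id 1 ∘ₗ
    (assocInv (H ⊗[k] H)).toLinearMap

@[simp] theorem betaAlpha_tmul (a b : H) (w : H ⊗[k] H) : Q.betaAlpha (a ⊗ₜ (b ⊗ₜ w)) =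
    Q.comul (a * Q.beta * Q.S b * Q.alpha) * w := by
  simp [betaAlpha]

theorem betaAlpha_mul_comulFst (x y) :
    Q.betaAlpha (y * Q.comulFst (H ⊗[k] H) x) =
      Q.betaAlpha y * Q.counitFst (H ⊗[k] H) x := by
  induction x using tensor_induction with
  | add x y hx hy => simp only [map_add, mul_add, hx, hy]
  | tmul a w =>
    induction y using tensor_induction₃ with
    | add x y hx hy => simp only [map_add, add_mul, hx, hy]
    | tmul y₁ y₂ y' =>
      have key : ∀ d : H ⊗[k] H, Q.betaAlpha ((y₁ ⊗ₜ (y₂ ⊗ₜ y')) *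
          Algebra.TensorProduct.assoc k k k H H (H ⊗[k] H) (d ⊗ₜ w)) =
          Q.comul (y₁ * Q.contractBeta d * Q.S y₂ * Q.alpha) * (y' * w) := by
        intro d
        induction d using tensor_induction with
        | add x y hx hy => simp only [map_add, TensorProduct.add_tmul, mul_add, add_mul, hx, hy]
        | tmul x y => simp [S_mul, mul_assoc]
      rw [comulFst_tmul, key, contractBeta_comul]
      simp [mul_assoc]

theorem betaAlpha_comulSnd (x) :
    Q.betaAlpha (idTensor H (Q.comulSnd H) x) = Q.comul (Q.zigzag x) := by
  induction x using tensor_induction₃ with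
  | add x y hx hy => simp only [map_add, hx, hy]
  | tmul a b c => simp [zigzag_tmul, mul_assoc]

/-- `a ⊗ b ⊗ c ⊗ d ↦ Δ(a β S(b)) U (c β S(d) ⊗ 1)`. -/
def doubleBetaU : H ⊗[k] (H ⊗[k] (H ⊗[k] H)) →ₗ[k] H ⊗[k] H :=
  sandwich (Q.comul.toLinearMap ∘ₗ Q.contractBeta) (inl.toLinearMap ∘ₗ Q.contractBeta) Q.U ∘ₗ
    (assocInv (H ⊗[k] H)).toLinearMap

theorem doubleBetaU_tmul (a b : H) (w : H ⊗[k] H) : Q.doubleBetaU (a ⊗ₜ (b ⊗ₜ w)) =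
    Q.comul (a * Q.beta * Q.S b) * Q.U * (Q.contractBeta w ⊗ₜ 1) := rfl

/-- `σ(V) = f p_R`. -/
theorem flipS_V : Q.flipS Q.V = Q.f * Q.pR := by
  have e : ∀ x, Q.flipS (Q.SS.symm (flip x)) = x := by
    intro x
    induction x using tensor_induction with
    | add x y hx hy => simp only [map_add, hx, hy]
    | tmul a b => simp [SS, flip]
  rw [V, h, flipS_mul, e, e]

theorem flipS_comul_S_symm (a : H) :
    Q.flipS (Q.comul (Q.S.symm a)) * Q.f = Q.f * Q.comul a := by
  rw [← f_mul_comul_S, LinearEquiv.apply_symm_apply]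

/-- `(a₂ ⊗ 1) V Δ(S⁻¹(a₁)) = (1 ⊗ S⁻¹(a)) V`. -/
theorem sandwich_V (a : H) :
    sandwich inl.toLinearMap (Q.comul.toLinearMap ∘ₗ Q.S.symm.toLinearMap) Q.V (flip (Q.comul a)) =
      (1 ⊗ₜ Q.S.symm a) * Q.V := by
  apply Q.flipS.injective
  have e : ∀ w, Q.flipS (sandwich inl.toLinearMap (Q.comul.toLinearMap ∘ₗ Q.S.symm.toLinearMap) Q.V
      (flip w)) =
      Q.f * sandwich Q.comul.toLinearMap (inr.toLinearMap ∘ₗ Q.S.toLinearMap) Q.pR w := by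
    intro w
    induction w using tensor_induction with
    | add x y hx hy => simp only [map_add, mul_add, hx, hy]
    | tmul b c =>
      simp [flip, flipS_mul, flipS_V, ← mul_assoc, ← flipS_comul_S_symm]
  rw [e, sandwich_pR, flipS_mul, flipS_V]
  simp [mul_assoc]

section

variable [FiniteDimensional k H]

theorem betaU_comulSnd_mul (w x) :
    Q.betaU (Q.comulSnd H w * x) =
      sandwich Q.comul.toLinearMap (inr.toLinearMap ∘ₗ Q.S.toLinearMap) (Q.betaU x) w := by
  induction w using tensor_induction with
  | add x y hx hy => simp only [map_add, add_mul, hx, hy]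
  | tmul a b =>
    induction x using tensor_induction₃ with
    | add x y hx hy => simp only [map_add, mul_add, hx, hy, sandwich_add]
    | tmul x₁ x₂ x₃ =>
      have key : ∀ d : H ⊗[k] H, Q.betaU ((a ⊗ₜ d) * (x₁ ⊗ₜ (x₂ ⊗ₜ x₃))) =
          Q.comul (a * x₁ * Q.beta * Q.S x₂) *
          sandwich (Q.comul.toLinearMap ∘ₗ Q.S.toLinearMap) inl.toLinearMap Q.U d * (x₃ ⊗ₜ 1) := by
        intro d
        induction d using tensor_induction with
        | add x y hx hy => simp only [map_add, TensorProduct.tmul_add, mul_add, add_mul, hx, hy]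
        | tmul x y => simp [betaU_tmul, S_mul, mul_assoc]
      rw [comulSnd_tmul, key, sandwich_U]
      simp [betaU_tmul, mul_assoc]

/-- `Δ(a₁) p' (1 ⊗ S(a₂)) = p' (a ⊗ 1)` for `p' = Δ(X β S(Y)) U (Z ⊗ 1)`. -/
theorem sandwich_betaU_phi (a : H) :
    sandwich Q.comul.toLinearMap (inr.toLinearMap ∘ₗ Q.S.toLinearMap) (Q.betaU Q.phi.val)
      (Q.comul a) = Q.betaU Q.phi.val * (a ⊗ₜ 1) := by
  rw [← betaU_comulSnd_mul, coassoc, betaU_mul_comulFst, counitFst_comul]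

/-- `Δ(X) p' (1 ⊗ S(Y) α Z) = 1` for `p' = Δ(X β S(Y)) U (Z ⊗ 1)`. -/
theorem sandwich_betaU_phi_phi :
    sandwich Q.comul.toLinearMap (inr.toLinearMap ∘ₗ Q.contractAlpha) (Q.betaU Q.phi.val)
      Q.phi.val = 1 := by
  have e1 : ∀ y, Q.betaU y * (1 ⊗ₜ Q.alpha) =
      Q.betaAlpha ((1 : H) ⊗ₜ[k] Q.phi.val * idTensor H (tensorOne H H H) y) := by
    intro y
    induction y using tensor_induction₃ with
    | add x y hx hy => simp only [map_add, mul_add, add_mul, hx, hy]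
    | tmul a b c =>
      have key : Q.betaU (a ⊗ₜ (b ⊗ₜ c)) * (1 ⊗ₜ Q.alpha) =
          Q.comul (a * Q.beta * Q.S b) * Q.phiEval * (c ⊗ₜ 1) := by
        rw [← U_mul_alpha]
        simp [betaU_tmul, mul_assoc]
      rw [key, phiEval]
      induction Q.phi.val using tensor_induction with
      | add x y hx hy => simp only [map_add, TensorProduct.tmul_add, mul_add, add_mul, hx, hy]
      | tmul x w => simp [S_mul, mul_assoc]
  have e2 : ∀ y (c : H), Q.betaAlpha (y * (1 ⊗ₜ (1 ⊗ₜ (1 ⊗ₜ c)))) = Q.betaAlpha y * (1 ⊗ₜ c) := by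
    intro y c
    induction y using tensor_induction₃ with
    | add x y hx hy => simp only [map_add, add_mul, hx, hy]
    | tmul a b w => simp [mul_assoc]
  have e3 : ∀ x y, sandwich Q.comul.toLinearMap (inr.toLinearMap ∘ₗ Q.contractAlpha) (Q.betaU y) x =
      Q.betaAlpha ((1 : H) ⊗ₜ[k] Q.phi.val * (idTensor H (Q.comulFst H) x *
        idTensor H (tensorOne H H H) y)) := by
    intro x y
    induction x using tensor_induction₃ with
    | add x y hx hy => simp only [map_add, mul_add, add_mul, hx, hy]
    | tmul a b c =>
      have h1 : ∀ d : H ⊗[k] H, ∀ y, (a ⊗ₜ[k] Algebra.TensorProduct.assoc k k k H H H (d ⊗ₜ c)) *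
          idTensor H (tensorOne H H H) y =
          idTensor H (tensorOne H H H) ((a ⊗ₜ d) * y) * (1 ⊗ₜ (1 ⊗ₜ (1 ⊗ₜ c))) := by
        intro d y
        induction d using tensor_induction with
        | add x y hx hy =>
          simp only [map_add, TensorProduct.add_tmul, TensorProduct.tmul_add, add_mul, hx, hy]
        | tmul d₁ d₂ =>
          induction y using tensor_induction₃ with
          | add x y hx hy => simp only [map_add, mul_add, add_mul, hx, hy]
          | tmul y₁ y₂ y₃ => simp
      rw [idTensor_tmul, comulFst_tmul, h1, ← mul_assoc, e2, ← e1, ← comulSnd_tmul,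
        betaU_comulSnd_mul]
      simp [mul_assoc]
  rw [e3, ← mul_assoc, ← pentagon', betaAlpha_mul_comulFst, betaAlpha_comulSnd, zigzag_phi,
    counitFst_phi, map_one, one_mul]

/-- `p_R = Δ(X β S(Y)) U (Z ⊗ 1)`. Writing `p'` for the right-hand side, multiply
`Δ(X) p' (1 ⊗ S(Y) α Z) = 1` by `p_R`: the relation `Δ(a₁) p' (1 ⊗ S(a₂)) = p' (a ⊗ 1)` and
`lTensor_zigzagInv_comulFst` turn the product into `p'`. -/
theorem betaU_phi : Q.betaU Q.phi.val = Q.pR := by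
  have e : ∀ x y, sandwich Q.comul.toLinearMap (inr.toLinearMap ∘ₗ Q.contractAlpha)
      (Q.betaU Q.phi.val) x * LinearMap.lTensor H Q.contractBeta y =
      sandwich Q.comul.toLinearMap inr.toLinearMap (Q.betaU Q.phi.val)
        (LinearMap.lTensor H Q.zigzagInv (idTensor H (tensorOne H H H) x *
          Q.comulFst (H ⊗[k] H) y)) := by
    intro x y
    induction x using tensor_induction₃ with
    | add x y hx hy => simp only [map_add, add_mul, hx, hy]
    | tmul a b c =>
      induction y using tensor_induction with
      | add x y hx hy => simp only [map_add, mul_add, hx, hy]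
      | tmul y₁ w =>
        have key : ∀ d : H ⊗[k] H, sandwich Q.comul.toLinearMap inr.toLinearMap (Q.betaU Q.phi.val)
            (LinearMap.lTensor H Q.zigzagInv ((a ⊗ₜ (b ⊗ₜ (c ⊗ₜ 1))) *
              Algebra.TensorProduct.assoc k k k H H (H ⊗[k] H) (d ⊗ₜ w))) =
            Q.comul a * sandwich Q.comul.toLinearMap (inr.toLinearMap ∘ₗ Q.S.toLinearMap)
              (Q.betaU Q.phi.val) d * (1 ⊗ₜ (Q.S b * Q.alpha * c * Q.contractBeta w)) := by
          intro d
          induction d using tensor_induction with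
          | add x y hx hy => simp only [map_add, TensorProduct.add_tmul, mul_add, add_mul, hx, hy]
          | tmul d₁ d₂ => simp [zigzagInv_tmul, S_mul, mul_assoc, contractBeta_tmul_mul]
        rw [comulFst_tmul, idTensor_tmul, tensorOne_tmul, key, sandwich_betaU_phi]
        simp [mul_assoc]
  have h := e Q.phi.val Q.phi.inv
  rw [sandwich_betaU_phi_phi, lTensor_zigzagInv_comulFst, one_mul, ← pR_eq,
    Algebra.TensorProduct.one_def, sandwich_tmul] at h
  rw [h]
  simp [← Algebra.TensorProduct.one_def]

/-- `p_R (β ⊗ 1) = Δ(x̄ β) f⁻¹ (S(z̄) ⊗ S(ȳ))`, where `φ⁻¹ = x̄ ⊗ ȳ ⊗ z̄`. -/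
theorem pR_mul_beta : Q.pR * (Q.beta ⊗ₜ 1) =
    sandwich (Q.comul.toLinearMap ∘ₗ LinearMap.mulRight k Q.beta) Q.flipS.toLinearMap Q.fInv
      Q.phi.inv := by
  have e0 : ∀ b, Q.fInv * (1 ⊗ₜ Q.S b) =
      sandwich (Q.comul.toLinearMap ∘ₗ Q.S.toLinearMap) inl.toLinearMap Q.U (Q.comul b * Q.pR) := by
    intro b
    rw [sandwich_mul_right, sandwich_U, sandwich_inl_mul_inr, ← fInv_eq]
    · intro x y; simp [S_mul]
    · intro x y; simp
  have e1 : ∀ x, sandwich (Q.comul.toLinearMap ∘ₗ LinearMap.mulRight k Q.beta) Q.flipS.toLinearMap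
      Q.fInv x = Q.doubleBetaU (idTensor H (Q.comulFst H) x * ((1 : H) ⊗ₜ[k] Q.phi.inv)) := by
    intro x
    induction x using tensor_induction₃ with
    | add x y hx hy => simp only [map_add, add_mul, hx, hy]
    | tmul a b c =>
      have h1 : sandwich (Q.comul.toLinearMap ∘ₗ LinearMap.mulRight k Q.beta) Q.flipS.toLinearMap
          Q.fInv (a ⊗ₜ (b ⊗ₜ c)) =
          Q.comul (a * Q.beta) * (Q.fInv * (1 ⊗ₜ Q.S b)) * (Q.S c ⊗ₜ 1) := by
        simp [mul_assoc]
      rw [h1, e0, idTensor_tmul, comulFst_tmul, pR_eq]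
      induction Q.phi.inv using tensor_induction with
      | add x y hx hy => simp only [map_add, TensorProduct.tmul_add, mul_add, add_mul, hx, hy]
      | tmul y₁ w =>
        induction Q.comul b using tensor_induction with
        | add x y hx hy =>
          simp only [map_add, TensorProduct.tmul_add, TensorProduct.add_tmul, mul_add, add_mul,
            hx, hy]
        | tmul d₁ d₂ =>
          simp [doubleBetaU_tmul, S_mul, mul_assoc, contractBeta_tmul_mul]
  have e2 : ∀ t x, Q.doubleBetaU (t * idTensor H (Q.comulSnd H) x) =
      Q.doubleBetaU (t * idTensor H (tensorOne H H H) (tensorOne H H H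
        (idTensor H (Q.counitSnd H) x))) := by
    intro t x
    induction x using tensor_induction₃ with
    | add x y hx hy => simp only [map_add, mul_add, hx, hy]
    | tmul a b c =>
      induction t using tensor_induction₃ with
      | add x y hx hy => simp only [map_add, add_mul, hx, hy]
      | tmul t₁ t₂ w =>
        simp [doubleBetaU_tmul, contractBeta_mul_comul, ← Algebra.TensorProduct.one_def,
          ← TensorProduct.smul_tmul']
  have e3 : ∀ t x, Q.doubleBetaU (t * Q.comulFst (H ⊗[k] H) x) =
      Q.doubleBetaU (t * (1 ⊗ₜ (1 ⊗ₜ Q.counitFst (H ⊗[k] H) x))) := by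
    intro t x
    induction x using tensor_induction with
    | add x y hx hy => simp only [map_add, mul_add, TensorProduct.tmul_add, hx, hy]
    | tmul a w' =>
      induction t using tensor_induction₃ with
      | add x y hx hy => simp only [map_add, add_mul, hx, hy]
      | tmul t₁ t₂ w =>
        have key : ∀ d : H ⊗[k] H, Q.doubleBetaU ((t₁ ⊗ₜ (t₂ ⊗ₜ w)) *
            Algebra.TensorProduct.assoc k k k H H (H ⊗[k] H) (d ⊗ₜ w')) =
            Q.comul (t₁ * Q.contractBeta d * Q.S t₂) * Q.U * (Q.contractBeta (w * w') ⊗ₜ 1) := by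
          intro d
          induction d using tensor_induction with
          | add x y hx hy => simp only [map_add, TensorProduct.add_tmul, mul_add, add_mul, hx, hy]
          | tmul x y => simp [doubleBetaU_tmul, S_mul, mul_assoc]
        rw [comulFst_tmul, key, contractBeta_comul]
        simp [doubleBetaU_tmul, TensorProduct.smul_tmul']
  have e4 : ∀ x, Q.doubleBetaU (idTensor H (tensorOne H H H) x) = Q.betaU x * (Q.beta ⊗ₜ 1) := by
    intro x
    induction x using tensor_induction₃ with
    | add x y hx hy => simp only [map_add, add_mul, hx, hy]
    | tmul a b c => simp [betaU_tmul, doubleBetaU_tmul, mul_assoc]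
  -- The pentagon reads
  -- `(id ⊗ Δ ⊗ id)(φ⁻¹) (1 ⊗ φ⁻¹) = (φ ⊗ 1) (Δ ⊗ id ⊗ id)(φ⁻¹) (id ⊗ id ⊗ Δ)(φ⁻¹)`, and the
  -- contraction `doubleBetaU` kills the coproducts in the last two factors.
  have h := congrArg (fun x => x * idTensor H (Q.comulSnd H) Q.phi.inv)
    Q.pentagon_phi_mul_comulFst_inv
  simp only [mul_assoc, map_phi_mul_inv, mul_one] at h
  rw [e1, ← h, ← mul_assoc, e2, Q.map_phi_inv_eq_one _ Q.counit_third_phi, map_one, map_one,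
    mul_one, e3, Q.map_phi_inv_eq_one _ Q.counitFst_phi, ← Algebra.TensorProduct.one_def,
    ← Algebra.TensorProduct.one_def, mul_one, e4, betaU_phi]

/-! ### The element `V` -/

/-- `(ȳ ⊗ z̄) Δ(S⁻¹(x̄ β))`, where `φ⁻¹ = x̄ ⊗ ȳ ⊗ z̄`. -/
def phiCoeval : H ⊗[k] H :=
  sandwich LinearMap.id (Q.comul.toLinearMap ∘ₗ Q.S.symm.toLinearMap)
    (Q.comul (Q.S.symm Q.beta)) (TensorProduct.comm k H (H ⊗[k] H) Q.phi.inv)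

/-- `(1 ⊗ S⁻¹(β)) V = (ȳ ⊗ z̄) Δ(S⁻¹(x̄ β))`. -/
theorem beta_mul_V : (1 ⊗ₜ Q.S.symm Q.beta) * Q.V = Q.phiCoeval := by
  apply Q.flipS.injective
  have e : ∀ x, Q.flipS (sandwich LinearMap.id (Q.comul.toLinearMap ∘ₗ Q.S.symm.toLinearMap)
      (Q.comul (Q.S.symm Q.beta)) (TensorProduct.comm k H (H ⊗[k] H) x)) =
      Q.f * sandwich (Q.comul.toLinearMap ∘ₗ LinearMap.mulRight k Q.beta) Q.flipS.toLinearMap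
        Q.fInv x := by
    intro x
    induction x using tensor_induction with
    | add x y hx hy => simp only [map_add, mul_add, hx, hy]
    | tmul a w =>
      have h1 : Q.flipS (Q.comul (Q.S.symm (a * Q.beta))) =
          Q.f * Q.comul (a * Q.beta) * Q.fInv := by
        rw [← flipS_comul_S_symm, mul_assoc, f_mul_fInv, mul_one]
      simp only [TensorProduct.comm_tmul, sandwich_tmul, flipS_mul, LinearMap.comp_apply,
        LinearMap.id_apply, AlgHom.toLinearMap_apply, LinearEquiv.coe_coe,
        LinearMap.mulRight_apply]
      rw [← mul_assoc, ← flipS_mul, ← map_mul Q.comul, ← S_symm_mul, h1, mul_assoc,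
        mul_assoc, mul_assoc]
  rw [phiCoeval, e, flipS_mul, flipS_V, ← pR_mul_beta]
  simp [mul_assoc]

end

/-! ### Cocycle identities for `U` and `V` -/

/-- The iterated coproduct `(Δ ⊗ id) Δ`. -/
def comul₃ : H →ₐ[k] H ⊗[k] (H ⊗[k] H) := (Q.comulFst H).comp Q.comul

theorem comul₃_apply (a : H) : Q.comul₃ a = Q.comulFst H (Q.comul a) := rfl

/-- `x ↦ 1 ⊗ 1 ⊗ x`. -/
abbrev inThird : H →ₐ[k] H ⊗[k] (H ⊗[k] H) :=
  (Algebra.TensorProduct.includeRight : H ⊗[k] H →ₐ[k] H ⊗[k] (H ⊗[k] H)).comp inr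

theorem tensorOne_mul_inThird (w : H ⊗[k] H) (c : H) :
    tensorOne H H H w * inThird (k := k) c = inThird (k := k) c * tensorOne H H H w := by
  induction w using tensor_induction with
  | add x y hx hy => simp only [map_add, add_mul, mul_add, hx, hy]
  | tmul a b => simp

theorem sandwich_tensorOne_mul_inThird {A : Type v} [AddCommGroup A] [Module k A]
    (g : A →ₗ[k] H ⊗[k] (H ⊗[k] H)) (M w) (c : H) :
    sandwich g (tensorOne (k := k) H H H).toLinearMap M w * inThird (k := k) c =
      sandwich g (tensorOne (k := k) H H H).toLinearMap (M * inThird (k := k) c) w := by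
  induction w using tensor_induction with
  | add x y hx hy => simp only [map_add, add_mul, hx, hy]
  | tmul a w =>
    simp only [sandwich_tmul, AlgHom.toLinearMap_apply, mul_assoc, tensorOne_mul_inThird]

theorem inThird_mul_sandwich_tensorOne {A : Type v} [AddCommGroup A] [Module k A]
    (g : A →ₗ[k] H ⊗[k] (H ⊗[k] H)) (M w) (c : H) :
    inThird (k := k) c * sandwich (tensorOne (k := k) H H H).toLinearMap g M w =
      sandwich (tensorOne (k := k) H H H).toLinearMap g (inThird (k := k) c * M) w := by
  induction w using tensor_induction with
  | add x y hx hy => simp only [map_add, mul_add, hx, hy]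
  | tmul w a =>
    simp only [sandwich_tmul, AlgHom.toLinearMap_apply, ← mul_assoc, tensorOne_mul_inThird]

/-- An element `M` of `H ⊗ H ⊗ H` with
`M (1 ⊗ 1 ⊗ S(a)) = (Δ ⊗ id)(Δ(S(a₁₁))) M (a₁₂ ⊗ a₂ ⊗ 1)` is determined by `M (1 ⊗ 1 ⊗ α)`. -/
theorem eq_of_mul_alpha_eq {M M' : H ⊗[k] (H ⊗[k] H)}
    (hM : ∀ a, sandwich (Q.comul₃.toLinearMap ∘ₗ Q.S.toLinearMap)
      (tensorOne (k := k) H H H).toLinearMap M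
      (Q.comulFst H (Q.comul a)) = M * inThird (k := k) (Q.S a))
    (hM' : ∀ a, sandwich (Q.comul₃.toLinearMap ∘ₗ Q.S.toLinearMap)
      (tensorOne (k := k) H H H).toLinearMap M'
      (Q.comulFst H (Q.comul a)) = M' * inThird (k := k) (Q.S a))
    (h : M * inThird (k := k) Q.alpha = M' * inThird (k := k) Q.alpha) : M = M' := by
  have key : ∀ x, M * inThird (k := k) (Q.zigzagInv x) = M' * inThird (k := k) (Q.zigzagInv x) := by
    intro x
    induction x using tensor_induction with
    | add x y hx hy => simp only [map_add, mul_add, hx, hy]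
    | tmul a w =>
      rw [zigzagInv_tmul, map_mul, map_mul, ← mul_assoc, ← mul_assoc, ← mul_assoc, ← mul_assoc,
        ← hM, ← hM', sandwich_tensorOne_mul_inThird, h, ← sandwich_tensorOne_mul_inThird]
  simpa only [zigzagInv_phi_inv, map_one, mul_one] using key Q.phi.inv

/-- An element `M` of `H ⊗ H ⊗ H` with
`(1 ⊗ 1 ⊗ S⁻¹(a)) M = (a₁₂ ⊗ a₂ ⊗ 1) M (Δ ⊗ id)(Δ(S⁻¹(a₁₁)))` is determined by
`(1 ⊗ 1 ⊗ S⁻¹(β)) M`. -/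
theorem eq_of_beta_mul_eq {M M' : H ⊗[k] (H ⊗[k] H)}
    (hM : ∀ a, sandwich (tensorOne (k := k) H H H).toLinearMap
      (Q.comul₃.toLinearMap ∘ₗ Q.S.symm.toLinearMap) M
      (TensorProduct.comm k H (H ⊗[k] H) (Q.comulFst H (Q.comul a))) =
        inThird (k := k) (Q.S.symm a) * M)
    (hM' : ∀ a, sandwich (tensorOne (k := k) H H H).toLinearMap
      (Q.comul₃.toLinearMap ∘ₗ Q.S.symm.toLinearMap) M'
      (TensorProduct.comm k H (H ⊗[k] H) (Q.comulFst H (Q.comul a))) =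
        inThird (k := k) (Q.S.symm a) * M')
    (h : inThird (k := k) (Q.S.symm Q.beta) * M = inThird (k := k) (Q.S.symm Q.beta) * M') :
    M = M' := by
  have key : ∀ x, inThird (k := k) (Q.S.symm (Q.zigzag x)) * M =
      inThird (k := k) (Q.S.symm (Q.zigzag x)) * M' := by
    intro x
    induction x using tensor_induction with
    | add x y hx hy => simp only [map_add, add_mul, hx, hy]
    | tmul a w =>
      rw [zigzag_tmul, S_symm_mul, S_symm_mul, map_mul, map_mul, mul_assoc, mul_assoc, mul_assoc,
        mul_assoc, ← hM, ← hM', inThird_mul_sandwich_tensorOne, h, ← inThird_mul_sandwich_tensorOne]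
  simpa only [zigzag_phi, S_symm_one, map_one, one_mul] using key Q.phi.val

theorem phi_inv_mul_comulSnd_comul (a : H) (x) :
    Q.phi.inv * (Q.comulSnd H (Q.comul a) * x) = Q.comul₃ a * (Q.phi.inv * x) := by
  rw [← mul_assoc, coassoc_inv, mul_assoc, comul₃_apply]

theorem comulSnd_comul_mul_phi (a : H) :
    Q.comulSnd H (Q.comul a) * Q.phi.val = Q.phi.val * Q.comul₃ a := Q.coassoc a

theorem one_tmul_mul_inThird (x : H ⊗[k] H) (c : H) :
    ((1 : H) ⊗ₜ[k] x) * inThird (k := k) c = 1 ⊗ₜ (x * (1 ⊗ₜ c)) := by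
  simp

theorem inThird_mul_one_tmul (x : H ⊗[k] H) (c : H) :
    inThird (k := k) c * ((1 : H) ⊗ₜ[k] x) = 1 ⊗ₜ ((1 ⊗ₜ c) * x) := by
  simp

theorem comulFst_one_tmul (c : H) : Q.comulFst H (1 ⊗ₜ c) = inThird (k := k) c := by
  simp [comulFst_tmul, Algebra.TensorProduct.one_def]

theorem comulFst_tmul_one (c : H) : Q.comulFst H (c ⊗ₜ 1) = tensorOne H H H (Q.comul c) := by
  rw [comulFst_tmul]
  induction Q.comul c using tensor_induction with
  | add x y hx hy => simp only [map_add, TensorProduct.add_tmul, hx, hy]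
  | tmul d₁ d₂ => simp

section

variable [FiniteDimensional k H]

/-- `φ⁻¹ (id ⊗ Δ)(U) (1 ⊗ U) = (Δ ⊗ id)(Δ(S(X))) (Δ ⊗ id)(U) (Y ⊗ Z ⊗ 1)`. -/
theorem U_cocycle :
    Q.phi.inv * Q.comulSnd H Q.U * (1 ⊗ₜ Q.U) =
      sandwich (Q.comul₃.toLinearMap ∘ₗ Q.S.toLinearMap) (tensorOne (k := k) H H H).toLinearMap
        (Q.comulFst H Q.U) Q.phi.val := by
  apply Q.eq_of_mul_alpha_eq
  · intro a
    rw [mul_assoc _ _ (inThird _), one_tmul_mul_inThird, ← sandwich_U]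
    have key : ∀ w, Q.phi.inv * Q.comulSnd H Q.U * ((1 : H) ⊗ₜ[k]
        sandwich (Q.comul.toLinearMap ∘ₗ Q.S.toLinearMap) inl.toLinearMap Q.U w) =
        sandwich (Q.comul₃.toLinearMap ∘ₗ Q.S.toLinearMap) (tensorOne (k := k) H H H).toLinearMap
          (Q.phi.inv * Q.comulSnd H Q.U * (1 ⊗ₜ Q.U)) (Q.comulFst H w) := by
      intro w
      induction w using tensor_induction with
      | add x y hx hy => simp only [map_add, TensorProduct.tmul_add, mul_add, hx, hy]
      | tmul b c =>
        have h0 : Q.phi.inv * Q.comulSnd H Q.U * ((1 : H) ⊗ₜ[k]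
            sandwich (Q.comul.toLinearMap ∘ₗ Q.S.toLinearMap) inl.toLinearMap Q.U (b ⊗ₜ c)) =
            Q.phi.inv * Q.comulSnd H (Q.U * (1 ⊗ₜ Q.S b)) * (1 ⊗ₜ Q.U) * (1 ⊗ₜ (c ⊗ₜ 1)) := by
          simp [mul_assoc]
        rw [h0, ← sandwich_U, comulFst_tmul]
        induction Q.comul b using tensor_induction with
        | add x y hx hy => simp only [map_add, TensorProduct.add_tmul, mul_add, add_mul, hx, hy]
        | tmul d₁ d₂ =>
          have h1 : ((d₂ ⊗ₜ[k] (1 : H ⊗[k] H)) * ((1 : H) ⊗ₜ[k] Q.U)) * (1 ⊗ₜ (c ⊗ₜ 1)) =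
              ((1 : H) ⊗ₜ[k] Q.U) * (d₂ ⊗ₜ (c ⊗ₜ 1)) := by simp
          simp only [sandwich_tmul, map_mul, LinearMap.comp_apply, LinearEquiv.coe_coe,
            AlgHom.toLinearMap_apply, mul_assoc, phi_inv_mul_comulSnd_comul,
            Algebra.TensorProduct.assoc_tmul, tensorOne_tmul]
          simp only [Algebra.TensorProduct.includeLeft_apply, comulSnd_tmul, map_one]
          rw [← mul_assoc (d₂ ⊗ₜ[k] (1 : H ⊗[k] H)), h1]
    rw [key]
  · intro a
    have e1 : ∀ w x, sandwich (Q.comul₃.toLinearMap ∘ₗ Q.S.toLinearMap)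
        (tensorOne (k := k) H H H).toLinearMap (Q.comulFst H Q.U) (Q.comulSnd H w * x) =
        sandwich (Q.comul₃.toLinearMap ∘ₗ Q.S.toLinearMap) (tensorOne (k := k) H H H).toLinearMap
          (Q.comulFst H (sandwich (Q.comul.toLinearMap ∘ₗ Q.S.toLinearMap) inl.toLinearMap Q.U w))
          x := by
      intro w x
      induction w using tensor_induction with
      | add x y hx hy => simp only [map_add, add_mul, hx, hy, sandwich_add]
      | tmul b c =>
        induction x using tensor_induction with
        | add x y hx hy => simp only [map_add, mul_add, hx, hy]
        | tmul x w =>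
          simp [comulFst_tmul_one, S_mul, mul_assoc, comul₃_apply]
    have e2 : ∀ w x, sandwich (Q.comul₃.toLinearMap ∘ₗ Q.S.toLinearMap)
        (tensorOne (k := k) H H H).toLinearMap (Q.comulFst H Q.U) (x * w) =
        sandwich (Q.comul₃.toLinearMap ∘ₗ Q.S.toLinearMap) (tensorOne (k := k) H H H).toLinearMap
          (sandwich (Q.comul₃.toLinearMap ∘ₗ Q.S.toLinearMap) (tensorOne (k := k) H H H).toLinearMap
            (Q.comulFst H Q.U) x) w := by
      intro w x
      apply sandwich_mul_right
      · intro x y; simp [S_mul]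
      · intro x y; simp
    rw [← e2, ← coassoc, e1, sandwich_U, map_mul]
    rw [comulFst_one_tmul, sandwich_tensorOne_mul_inThird]
  · -- Both sides become `Δ₃(S(x) α) w` for the two sides `x ⊗ w` of the pentagon.
    have hL : Q.phi.inv * Q.comulSnd H Q.U * (1 ⊗ₜ Q.U) * inThird (k := k) Q.alpha =
        sandwich (Q.comul₃.toLinearMap ∘ₗ Q.S.toLinearMap) LinearMap.id (Q.comul₃ Q.alpha)
          (((1 : H) ⊗ₜ[k] Q.phi.inv) * (idTensor H (Q.comulSnd H) Q.phi.val *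
            Q.comulFst (H ⊗[k] H) Q.phi.val)) := by
      have e1 : ∀ x y, Q.phi.inv * Q.comulSnd H (sandwich (Q.comul.toLinearMap ∘ₗ Q.S.toLinearMap)
          LinearMap.id (Q.comul Q.alpha) x) * y =
          sandwich (Q.comul₃.toLinearMap ∘ₗ Q.S.toLinearMap) LinearMap.id (Q.comul₃ Q.alpha)
          (((1 : H) ⊗ₜ[k] Q.phi.inv) * idTensor H (Q.comulSnd H) x) * y := by
        intro x y
        induction x using tensor_induction with
        | add x y hx hy => simp only [map_add, mul_add, add_mul, hx, hy]
        | tmul a w =>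
          simp only [sandwich_tmul, map_mul, LinearMap.comp_apply, LinearEquiv.coe_coe,
            AlgHom.toLinearMap_apply, mul_assoc, phi_inv_mul_comulSnd_comul, idTensor_tmul,
            Algebra.TensorProduct.tmul_mul_tmul, one_mul, LinearMap.id_apply]
      have e2 : ∀ x, Q.phi.inv * Q.comulSnd H Q.U * ((1 : H) ⊗ₜ[k]
          sandwich (Q.comul.toLinearMap ∘ₗ Q.S.toLinearMap) LinearMap.id (Q.comul Q.alpha) x) =
          sandwich (Q.comul₃.toLinearMap ∘ₗ Q.S.toLinearMap) LinearMap.id (Q.comul₃ Q.alpha)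
          (((1 : H) ⊗ₜ[k] Q.phi.inv) * (idTensor H (Q.comulSnd H) Q.phi.val *
            Q.comulFst (H ⊗[k] H) x)) := by
        intro x
        induction x using tensor_induction with
        | add x y hx hy => simp only [map_add, TensorProduct.tmul_add, mul_add, hx, hy]
        | tmul a w =>
          have h0 : Q.phi.inv * Q.comulSnd H Q.U * ((1 : H) ⊗ₜ[k] sandwich
              (Q.comul.toLinearMap ∘ₗ Q.S.toLinearMap) LinearMap.id (Q.comul Q.alpha) (a ⊗ₜ w)) =
              Q.phi.inv * Q.comulSnd H (Q.U * (1 ⊗ₜ Q.S a) * (1 ⊗ₜ Q.alpha)) * (1 ⊗ₜ w) := by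
            simp [mul_assoc]
          rw [h0, ← sandwich_U, ← sandwich_inl_mul_inr, U_mul_alpha, comulFst_tmul, ← mul_assoc]
          induction Q.comul a using tensor_induction with
          | add x y hx hy => simp only [map_add, TensorProduct.add_tmul, mul_add, add_mul, hx, hy]
          | tmul d₁ d₂ =>
            have h1 : Q.phi.inv * Q.comulSnd H (sandwich (Q.comul.toLinearMap ∘ₗ Q.S.toLinearMap)
                inl.toLinearMap Q.phiEval (d₁ ⊗ₜ d₂)) * (1 ⊗ₜ w) =
                Q.comul₃ (Q.S d₁) * (Q.phi.inv * Q.comulSnd H Q.phiEval * (d₂ ⊗ₜ w)) := by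
              simp only [sandwich_tmul, map_mul, LinearMap.comp_apply, LinearEquiv.coe_coe,
                AlgHom.toLinearMap_apply, mul_assoc, phi_inv_mul_comulSnd_comul]
              simp
            rw [h1, phiEval, e1, Algebra.TensorProduct.assoc_tmul]
            generalize ((1 : H) ⊗ₜ[k] Q.phi.inv) * idTensor H (Q.comulSnd H) Q.phi.val = t
            induction t using tensor_induction with
            | add x y hx hy => simp only [map_add, mul_add, add_mul, hx, hy]
            | tmul t w => simp [S_mul, mul_assoc]
      rw [mul_assoc _ _ (inThird _), one_tmul_mul_inThird, U_mul_alpha]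
      exact e2 _
    have hR : sandwich (Q.comul₃.toLinearMap ∘ₗ Q.S.toLinearMap)
        (tensorOne (k := k) H H H).toLinearMap (Q.comulFst H Q.U) Q.phi.val *
          inThird (k := k) Q.alpha =
        sandwich (Q.comul₃.toLinearMap ∘ₗ Q.S.toLinearMap) LinearMap.id (Q.comul₃ Q.alpha)
          (idTensor H (Q.comulFst H) Q.phi.val * idTensor H (tensorOne H H H) Q.phi.val) := by
      have h2 : Q.comulFst H Q.U * inThird (k := k) Q.alpha = Q.comulFst H Q.phiEval := by
        rw [← U_mul_alpha, map_mul, comulFst_one_tmul]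
      have e1 : ∀ x y, sandwich (Q.comul₃.toLinearMap ∘ₗ Q.S.toLinearMap)
          (tensorOne (k := k) H H H).toLinearMap (Q.comulFst H (sandwich
            (Q.comul.toLinearMap ∘ₗ Q.S.toLinearMap) LinearMap.id (Q.comul Q.alpha) x)) y =
          sandwich (Q.comul₃.toLinearMap ∘ₗ Q.S.toLinearMap) LinearMap.id (Q.comul₃ Q.alpha)
            (idTensor H (Q.comulFst H) x * idTensor H (tensorOne H H H) y) := by
        intro x y
        induction x using tensor_induction with
        | add x y hx hy => simp only [map_add, add_mul, hx, hy, sandwich_add]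
        | tmul a w =>
          induction y using tensor_induction with
          | add x y hx hy => simp only [map_add, mul_add, hx, hy]
          | tmul b w' => simp [S_mul, mul_assoc, comul₃_apply]
      rw [sandwich_tensorOne_mul_inThird, h2, phiEval, e1]
    rw [hL, hR, pentagon', ← mul_assoc, ← mul_assoc, one_tmul_phi_inv_mul, one_mul]

end

theorem inr_mul_sandwich_inl {A : Type v} [AddCommGroup A] [Module k A] (g : A →ₗ[k] H ⊗[k] H)
    (r w) (c : H) : sandwich inl.toLinearMap g (((1 : H) ⊗ₜ[k] c) * r) w =
      ((1 : H) ⊗ₜ[k] c) * sandwich inl.toLinearMap g r w := by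
  induction w using tensor_induction with
  | add x y hx hy => simp only [map_add, mul_add, hx, hy]
  | tmul a w => simp [← mul_assoc]

section

variable [FiniteDimensional k H]

/-- `(1 ⊗ V) (id ⊗ Δ)(V) φ = (ȳ ⊗ z̄ ⊗ 1) (Δ ⊗ id)(V) (Δ ⊗ id)(Δ(S⁻¹(x̄)))`. -/
theorem V_cocycle :
    (1 ⊗ₜ Q.V) * (Q.comulSnd H Q.V * Q.phi.val) =
      sandwich (tensorOne (k := k) H H H).toLinearMap (Q.comul₃.toLinearMap ∘ₗ Q.S.symm.toLinearMap)
        (Q.comulFst H Q.V) (TensorProduct.comm k H (H ⊗[k] H) Q.phi.inv) := by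
  apply Q.eq_of_beta_mul_eq
  · intro a
    rw [← mul_assoc (inThird _), inThird_mul_one_tmul, ← sandwich_V]
    have key : ∀ w, ((1 : H) ⊗ₜ[k]
        sandwich inl.toLinearMap (Q.comul.toLinearMap ∘ₗ Q.S.symm.toLinearMap) Q.V (flip w)) *
          (Q.comulSnd H Q.V * Q.phi.val) =
        sandwich (tensorOne (k := k) H H H).toLinearMap
          (Q.comul₃.toLinearMap ∘ₗ Q.S.symm.toLinearMap)
          ((1 ⊗ₜ Q.V) * (Q.comulSnd H Q.V * Q.phi.val))
          (TensorProduct.comm k H (H ⊗[k] H) (Q.comulFst H w)) := by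
      intro w
      induction w using tensor_induction with
      | add x y hx hy => simp only [map_add, TensorProduct.tmul_add, add_mul, hx, hy]
      | tmul b c =>
        have h0 : ((1 : H) ⊗ₜ[k] sandwich inl.toLinearMap
            (Q.comul.toLinearMap ∘ₗ Q.S.symm.toLinearMap) Q.V (flip (b ⊗ₜ c))) *
              (Q.comulSnd H Q.V * Q.phi.val) =
            (1 ⊗ₜ (c ⊗ₜ 1)) * ((1 ⊗ₜ Q.V) *
              (Q.comulSnd H ((1 ⊗ₜ Q.S.symm b) * Q.V) * Q.phi.val)) := by
          simp [← mul_assoc, flip]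
        rw [h0, ← sandwich_V, comulFst_tmul]
        induction Q.comul b using tensor_induction with
        | add x y hx hy => simp only [map_add, TensorProduct.add_tmul, mul_add, add_mul, hx, hy]
        | tmul d₁ d₂ =>
          have h1 : ((1 : H) ⊗ₜ[k] (c ⊗ₜ (1 : H))) * (((1 : H) ⊗ₜ[k] Q.V) *
              (d₂ ⊗ₜ[k] (1 : H ⊗[k] H))) = (d₂ ⊗ₜ (c ⊗ₜ 1)) * ((1 : H) ⊗ₜ[k] Q.V) := by simp
          simp only [flip, TensorProduct.comm_tmul, sandwich_tmul, map_mul, LinearMap.comp_apply,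
            LinearEquiv.coe_coe,
            AlgHom.toLinearMap_apply, mul_assoc, comulSnd_comul_mul_phi,
            Algebra.TensorProduct.assoc_tmul, tensorOne_tmul]
          simp only [Algebra.TensorProduct.includeLeft_apply, comulSnd_tmul, map_one]
          rw [← mul_assoc ((d₂ ⊗ₜ[k] (c ⊗ₜ[k] (1 : H)))), ← h1]
          simp only [mul_assoc]
    rw [key]
  · intro a
    have e1 : ∀ w x, sandwich (tensorOne (k := k) H H H).toLinearMap
        (Q.comul₃.toLinearMap ∘ₗ Q.S.symm.toLinearMap) (Q.comulFst H Q.V)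
          (TensorProduct.comm k H (H ⊗[k] H) (x * Q.comulSnd H w)) =
        sandwich (tensorOne (k := k) H H H).toLinearMap
          (Q.comul₃.toLinearMap ∘ₗ Q.S.symm.toLinearMap)
          (Q.comulFst H (sandwich inl.toLinearMap
            (Q.comul.toLinearMap ∘ₗ Q.S.symm.toLinearMap) Q.V (flip w)))
          (TensorProduct.comm k H (H ⊗[k] H) x) := by
      intro w x
      induction w using tensor_induction with
      | add x y hx hy => simp only [map_add, mul_add, hx, hy, sandwich_add]
      | tmul b c =>
        induction x using tensor_induction with
        | add x y hx hy => simp only [map_add, add_mul, hx, hy]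
        | tmul x w =>
          simp [comulFst_tmul_one, S_symm_mul, mul_assoc, comul₃_apply, flip]
    have e2 : ∀ w x, sandwich (tensorOne (k := k) H H H).toLinearMap
        (Q.comul₃.toLinearMap ∘ₗ Q.S.symm.toLinearMap) (Q.comulFst H Q.V)
          (TensorProduct.comm k H (H ⊗[k] H) (w * x)) =
        sandwich (tensorOne (k := k) H H H).toLinearMap
          (Q.comul₃.toLinearMap ∘ₗ Q.S.symm.toLinearMap)
          (sandwich (tensorOne (k := k) H H H).toLinearMap
            (Q.comul₃.toLinearMap ∘ₗ Q.S.symm.toLinearMap)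
            (Q.comulFst H Q.V) (TensorProduct.comm k H (H ⊗[k] H) x))
          (TensorProduct.comm k H (H ⊗[k] H) w) := by
      intro w x
      rw [← sandwich_mul_left]
      · congr 1
        exact map_mul (Algebra.TensorProduct.comm k H (H ⊗[k] H)) w x
      · intro x y; simp
      · intro x y; simp [S_symm_mul]
    rw [← e2, ← coassoc_inv, e1, sandwich_V, map_mul, comulFst_one_tmul,
      inThird_mul_sandwich_tensorOne]
  · -- Both sides become `w Δ₃(S⁻¹(x β))` for the two sides `x ⊗ w` of the inverse pentagon.
    have hL : inThird (k := k) (Q.S.symm Q.beta) *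
        ((1 ⊗ₜ Q.V) * (Q.comulSnd H Q.V * Q.phi.val)) =
        sandwich LinearMap.id (Q.comul₃.toLinearMap ∘ₗ Q.S.symm.toLinearMap)
          (Q.comul₃ (Q.S.symm Q.beta))
          (TensorProduct.comm k H (H ⊗[k] (H ⊗[k] H)) (Q.comulFst (H ⊗[k] H) Q.phi.inv *
            idTensor H (Q.comulSnd H) Q.phi.inv * ((1 : H) ⊗ₜ[k] Q.phi.val))) := by
      have e1 : ∀ x y, y * (Q.comulSnd H (sandwich LinearMap.id
          (Q.comul.toLinearMap ∘ₗ Q.S.symm.toLinearMap) (Q.comul (Q.S.symm Q.beta))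
            (TensorProduct.comm k H (H ⊗[k] H) x)) * Q.phi.val) =
          y * sandwich LinearMap.id (Q.comul₃.toLinearMap ∘ₗ Q.S.symm.toLinearMap)
            (Q.comul₃ (Q.S.symm Q.beta)) (TensorProduct.comm k H (H ⊗[k] (H ⊗[k] H))
              (idTensor H (Q.comulSnd H) x * ((1 : H) ⊗ₜ[k] Q.phi.val))) := by
        intro x y
        induction x using tensor_induction with
        | add x y hx hy => simp only [map_add, mul_add, add_mul, hx, hy]
        | tmul a w =>
          have h3 : ∀ c x, Q.comulSnd H (Q.comul c) * (Q.phi.val * x) =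
              Q.phi.val * (Q.comul₃ c * x) := fun c x => by
            rw [← mul_assoc, comulSnd_comul_mul_phi, mul_assoc]
          simp only [sandwich_tmul, map_mul, LinearMap.comp_apply, LinearEquiv.coe_coe,
            AlgHom.toLinearMap_apply, mul_assoc, comulSnd_comul_mul_phi, idTensor_tmul,
            Algebra.TensorProduct.tmul_mul_tmul, mul_one, LinearMap.id_apply,
            TensorProduct.comm_tmul, h3]
      have e2 : ∀ x, ((1 : H) ⊗ₜ[k] sandwich LinearMap.id
          (Q.comul.toLinearMap ∘ₗ Q.S.symm.toLinearMap) (Q.comul (Q.S.symm Q.beta))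
            (TensorProduct.comm k H (H ⊗[k] H) x)) * (Q.comulSnd H Q.V * Q.phi.val) =
          sandwich LinearMap.id (Q.comul₃.toLinearMap ∘ₗ Q.S.symm.toLinearMap)
            (Q.comul₃ (Q.S.symm Q.beta)) (TensorProduct.comm k H (H ⊗[k] (H ⊗[k] H))
              (Q.comulFst (H ⊗[k] H) x * (idTensor H (Q.comulSnd H) Q.phi.inv *
                ((1 : H) ⊗ₜ[k] Q.phi.val)))) := by
        intro x
        induction x using tensor_induction with
        | add x y hx hy => simp only [map_add, TensorProduct.tmul_add, add_mul, hx, hy]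
        | tmul a w =>
          have h0 : ((1 : H) ⊗ₜ[k] sandwich LinearMap.id
              (Q.comul.toLinearMap ∘ₗ Q.S.symm.toLinearMap) (Q.comul (Q.S.symm Q.beta))
                (TensorProduct.comm k H (H ⊗[k] H) (a ⊗ₜ w))) * (Q.comulSnd H Q.V * Q.phi.val) =
              (1 ⊗ₜ w) * (Q.comulSnd H ((1 ⊗ₜ Q.S.symm Q.beta) * ((1 ⊗ₜ Q.S.symm a) * Q.V)) *
                Q.phi.val) := by
            simp [← mul_assoc]
          rw [h0, ← sandwich_V, ← inr_mul_sandwich_inl, beta_mul_V, comulFst_tmul]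
          induction Q.comul a using tensor_induction with
          | add x y hx hy => simp only [map_add, TensorProduct.add_tmul, mul_add, add_mul, hx, hy]
          | tmul d₁ d₂ =>
            have h1 : (1 ⊗ₜ w) * (Q.comulSnd H (sandwich inl.toLinearMap
                (Q.comul.toLinearMap ∘ₗ Q.S.symm.toLinearMap) Q.phiCoeval (flip (d₁ ⊗ₜ d₂))) *
                  Q.phi.val) =
                (d₂ ⊗ₜ w) * (Q.comulSnd H Q.phiCoeval * Q.phi.val) * Q.comul₃ (Q.S.symm d₁) := by
              simp only [flip, TensorProduct.comm_tmul, sandwich_tmul, map_mul,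
                LinearMap.comp_apply, LinearEquiv.coe_coe,
                AlgHom.toLinearMap_apply, mul_assoc, comulSnd_comul_mul_phi]
              simp [← mul_assoc]
            rw [h1, phiCoeval, e1, Algebra.TensorProduct.assoc_tmul]
            generalize idTensor H (Q.comulSnd H) Q.phi.inv * ((1 : H) ⊗ₜ[k] Q.phi.val) = t
            induction t using tensor_induction with
            | add x y hx hy => simp only [map_add, mul_add, add_mul, hx, hy]
            | tmul t w => simp [S_symm_mul, mul_assoc]
      rw [← mul_assoc (inThird _), inThird_mul_one_tmul, beta_mul_V, mul_assoc (Q.comulFst _ _)]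
      exact e2 _
    have hR : inThird (k := k) (Q.S.symm Q.beta) * sandwich (tensorOne (k := k) H H H).toLinearMap
        (Q.comul₃.toLinearMap ∘ₗ Q.S.symm.toLinearMap)
        (Q.comulFst H Q.V) (TensorProduct.comm k H (H ⊗[k] H) Q.phi.inv) =
        sandwich LinearMap.id (Q.comul₃.toLinearMap ∘ₗ Q.S.symm.toLinearMap)
          (Q.comul₃ (Q.S.symm Q.beta))
          (TensorProduct.comm k H (H ⊗[k] (H ⊗[k] H)) (idTensor H (tensorOne H H H) Q.phi.inv *
            idTensor H (Q.comulFst H) Q.phi.inv)) := by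
      have h2 : inThird (k := k) (Q.S.symm Q.beta) * Q.comulFst H Q.V =
          Q.comulFst H Q.phiCoeval := by
        rw [← beta_mul_V, map_mul, comulFst_one_tmul]
      have e1 : ∀ x y, sandwich (tensorOne (k := k) H H H).toLinearMap
          (Q.comul₃.toLinearMap ∘ₗ Q.S.symm.toLinearMap) (Q.comulFst H (sandwich LinearMap.id
            (Q.comul.toLinearMap ∘ₗ Q.S.symm.toLinearMap) (Q.comul (Q.S.symm Q.beta))
              (TensorProduct.comm k H (H ⊗[k] H) x))) (TensorProduct.comm k H (H ⊗[k] H) y) =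
          sandwich LinearMap.id (Q.comul₃.toLinearMap ∘ₗ Q.S.symm.toLinearMap)
            (Q.comul₃ (Q.S.symm Q.beta)) (TensorProduct.comm k H (H ⊗[k] (H ⊗[k] H))
              (idTensor H (tensorOne H H H) y * idTensor H (Q.comulFst H) x)) := by
        intro x y
        induction x using tensor_induction with
        | add x y hx hy => simp only [map_add, mul_add, hx, hy, sandwich_add]
        | tmul a w =>
          induction y using tensor_induction with
          | add x y hx hy => simp only [map_add, add_mul, hx, hy]
          | tmul b w' => simp [S_symm_mul, mul_assoc, comul₃_apply]
      rw [inThird_mul_sandwich_tensorOne, h2, phiCoeval, e1]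
    have hp : Q.comulFst (H ⊗[k] H) Q.phi.inv * idTensor H (Q.comulSnd H) Q.phi.inv *
        ((1 : H) ⊗ₜ[k] Q.phi.val) =
        idTensor H (tensorOne H H H) Q.phi.inv * idTensor H (Q.comulFst H) Q.phi.inv := by
      have h := congrArg (fun x => idTensor H (tensorOne H H H) Q.phi.inv * (x *
        (idTensor H (Q.comulSnd H) Q.phi.inv * ((1 : H) ⊗ₜ[k] Q.phi.val))))
        Q.pentagon_phi_mul_comulFst_inv
      have c1 : ∀ x, idTensor H (tensorOne H H H) Q.phi.inv *
          (idTensor H (tensorOne H H H) Q.phi.val * x) = x := fun x => by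
        rw [← mul_assoc, map_phi_inv_mul, one_mul]
      have c2 : ∀ x, idTensor H (Q.comulSnd H) Q.phi.val *
          (idTensor H (Q.comulSnd H) Q.phi.inv * x) = x := fun x => by
        rw [← mul_assoc, map_phi_mul_inv, one_mul]
      simpa only [mul_assoc, c1, c2, one_tmul_phi_inv_mul, mul_one] using h
    rw [hL, hR, hp]

end

/-! ### The deformed coproduct -/

theorem comulBar_apply (m : H) : Q.comulBar m = Q.V * (Q.comul m * Q.U) := rfl

/-- An element that commutes with `S(H) = H` and fixes `α` is `1`, as `S(x̄) α ȳ β S(z̄) = 1`. -/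
theorem eq_one_of_mul_alpha_eq (u : H) (hu : ∀ b, u * Q.S b = Q.S b * u)
    (h : u * Q.alpha = Q.alpha) : u = 1 := by
  have key : ∀ x, u * Q.zigzagInv x = Q.zigzagInv x := by
    intro x
    induction x using tensor_induction with
    | add x y hx hy => simp only [map_add, mul_add, hx, hy]
    | tmul a w => rw [zigzagInv_tmul, ← mul_assoc, ← mul_assoc, hu, mul_assoc _ u, h]
  simpa only [zigzagInv_phi_inv, mul_one] using key Q.phi.inv

/-- An element that commutes with `S⁻¹(H) = H` and fixes `S⁻¹(β)` is `1`, as `X β S(Y) α Z = 1`. -/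
theorem eq_one_of_beta_mul_eq (u : H) (hu : ∀ b, Q.S.symm b * u = u * Q.S.symm b)
    (h : Q.S.symm Q.beta * u = Q.S.symm Q.beta) : u = 1 := by
  have key : ∀ x, Q.S.symm (Q.zigzag x) * u = Q.S.symm (Q.zigzag x) := by
    intro x
    induction x using tensor_induction with
    | add x y hx hy => simp only [map_add, add_mul, hx, hy]
    | tmul a w =>
      rw [zigzag_tmul, S_symm_mul, S_symm_mul, mul_assoc, mul_assoc, hu, ← mul_assoc _ u, h]
  simpa only [zigzag_phi, S_symm_one, one_mul] using key Q.phi.val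

/-- `(a₂ ⊗ 1) Δ̄(S⁻¹(a₁) m) = (1 ⊗ S⁻¹(a)) Δ̄(m)`. -/
theorem sandwich_comulBar_left (m a : H) :
    sandwich inl.toLinearMap (Q.comulBar ∘ₗ LinearMap.mulRight k m ∘ₗ Q.S.symm.toLinearMap) 1
      (flip (Q.comul a)) = (1 ⊗ₜ Q.S.symm a) * Q.comulBar m := by
  have e : ∀ w, sandwich inl.toLinearMap
      (Q.comulBar ∘ₗ LinearMap.mulRight k m ∘ₗ Q.S.symm.toLinearMap) 1 w =
      sandwich inl.toLinearMap (Q.comul.toLinearMap ∘ₗ Q.S.symm.toLinearMap) Q.V w *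
        (Q.comul m * Q.U) := by
    intro w
    induction w using tensor_induction with
    | add x y hx hy => simp only [map_add, add_mul, hx, hy]
    | tmul b c => simp [comulBar_apply, mul_assoc]
  rw [e, sandwich_V, comulBar_apply]
  simp only [mul_assoc]

section

variable [FiniteDimensional k H]

theorem counitFst_U : Q.counitFst H Q.U = 1 := by
  apply Q.eq_one_of_mul_alpha_eq
  · intro b
    have h := congrArg (Q.counitFst H) (Q.sandwich_U b)
    have e : ∀ w, Q.counitFst H (sandwich (Q.comul.toLinearMap ∘ₗ Q.S.toLinearMap) inl.toLinearMap
        Q.U w) = Q.S (Q.counitSnd H w) * Q.counitFst H Q.U := by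
      intro w
      induction w using tensor_induction with
      | add x y hx hy => simp only [map_add, add_mul, hx, hy]
      | tmul b c => simp
    rw [e] at h
    simpa using h.symm
  · have h := congrArg (Q.counitFst H) Q.U_mul_alpha
    have e : ∀ x, Q.counitFst H (sandwich (Q.comul.toLinearMap ∘ₗ Q.S.toLinearMap) LinearMap.id
        (Q.comul Q.alpha) x) =
        Q.contractAlpha (idTensor H (Q.counitFst H) x) := by
      intro x
      induction x using tensor_induction with
      | add x y hx hy => simp only [map_add, hx, hy]
      | tmul b c => simp
    rw [phiEval, e, counit_phi'] at h
    simpa [Algebra.TensorProduct.one_def] using h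

theorem counitFst_V : Q.counitFst H Q.V = 1 := by
  apply Q.eq_one_of_beta_mul_eq
  · intro b
    have h := congrArg (Q.counitFst H) (Q.sandwich_V b)
    have e : ∀ w, Q.counitFst H (sandwich inl.toLinearMap
        (Q.comul.toLinearMap ∘ₗ Q.S.symm.toLinearMap) Q.V (flip w)) =
        Q.counitFst H Q.V * Q.S.symm (Q.counitSnd H w) := by
      intro w
      induction w using tensor_induction with
      | add x y hx hy => simp only [map_add, mul_add, hx, hy]
      | tmul b c => simp [flip]
    rw [e] at h
    simpa using h.symm
  · have h := congrArg (Q.counitFst H) Q.beta_mul_V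
    have e : ∀ x, Q.counitFst H (sandwich LinearMap.id
        (Q.comul.toLinearMap ∘ₗ Q.S.symm.toLinearMap) (Q.comul (Q.S.symm Q.beta))
          (TensorProduct.comm k H (H ⊗[k] H) x)) =
        sandwich LinearMap.id Q.S.symm.toLinearMap (Q.S.symm Q.beta)
          (flip (idTensor H (Q.counitFst H) x)) := by
      intro x
      induction x using tensor_induction with
      | add x y hx hy => simp only [map_add, hx, hy]
      | tmul b c => simp [flip]
    rw [phiCoeval, e, Q.map_phi_inv_eq_one _ Q.counit_phi'] at h
    simpa [Algebra.TensorProduct.one_def, flip] using h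

/-- `(ε ⊗ id) Δ̄ = id`. -/
theorem counitFst_comulBar (m : H) : Q.counitFst H (Q.comulBar m) = m := by
  simp [comulBar_apply, counitFst_U, counitFst_V]

/-- `Δ̄(m S(b₁)) (b₂ ⊗ 1) = Δ̄(m) (1 ⊗ S(b))`. -/
theorem sandwich_comulBar_right (m b : H) :
    sandwich (Q.comulBar ∘ₗ LinearMap.mulLeft k m ∘ₗ Q.S.toLinearMap) inl.toLinearMap 1
        (Q.comul b) =
      Q.comulBar m * (1 ⊗ₜ Q.S b) := by
  have e : ∀ w, sandwich (Q.comulBar ∘ₗ LinearMap.mulLeft k m ∘ₗ Q.S.toLinearMap) inl.toLinearMap 1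
      w = Q.V * (Q.comul m *
        sandwich (Q.comul.toLinearMap ∘ₗ Q.S.toLinearMap) inl.toLinearMap Q.U w) := by
    intro w
    induction w using tensor_induction with
    | add x y hx hy => simp only [map_add, mul_add, hx, hy]
    | tmul b c => simp [comulBar_apply, mul_assoc]
  rw [e, sandwich_U, comulBar_apply]
  simp only [mul_assoc]

/-- `(id ⊗ Δ̄)(Δ̄(m)) = (ȳ ⊗ z̄ ⊗ 1) (Δ ⊗ id)(Δ̄(S⁻¹(x̄) m S(X))) (Y ⊗ Z ⊗ 1)`, with the right-hand
side factored as a product. -/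
theorem lTensor_comulBar (m : H) :
    LinearMap.lTensor H Q.comulBar (Q.comulBar m) =
      sandwich (tensorOne (k := k) H H H).toLinearMap (Q.comul₃.toLinearMap ∘ₗ Q.S.symm.toLinearMap)
        (Q.comulFst H Q.V) (TensorProduct.comm k H (H ⊗[k] H) Q.phi.inv) *
      (Q.comul₃ m *
      sandwich (Q.comul₃.toLinearMap ∘ₗ Q.S.toLinearMap) (tensorOne (k := k) H H H).toLinearMap
        (Q.comulFst H Q.U) Q.phi.val) := by
  have e : ∀ w, LinearMap.lTensor H Q.comulBar w =
      (1 ⊗ₜ Q.V) * (Q.comulSnd H w * (1 ⊗ₜ Q.U)) := by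
    intro w
    induction w using tensor_induction with
    | add x y hx hy => simp only [map_add, mul_add, add_mul, hx, hy]
    | tmul b c => simp [comulBar_apply]
  have h3 : ∀ x, Q.phi.val * (Q.comul₃ m * (Q.phi.inv * x)) = Q.comulSnd H (Q.comul m) * x := by
    intro x
    rw [← mul_assoc, ← mul_assoc, ← comulSnd_comul_mul_phi, mul_assoc (Q.comulSnd H _), phi_mul_inv,
      mul_one]
  rw [← U_cocycle, ← V_cocycle, e, comulBar_apply]
  simp only [map_mul, mul_assoc, h3]

end

/-! ### The dual as a quasi-Hopf bimodule -/

theorem dualLeft_one (ψ : Module.Dual k H) : Q.dualLeft 1 ψ = ψ := by ext; simp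

theorem dualLeft_mul (a b : H) (ψ : Module.Dual k H) :
    Q.dualLeft (a * b) ψ = Q.dualLeft a (Q.dualLeft b ψ) := by
  ext; simp [S_symm_mul, mul_assoc]

theorem dualRight_one (ψ : Module.Dual k H) : Q.dualRight ψ 1 = ψ := by ext; simp

theorem dualRight_mul (a b : H) (ψ : Module.Dual k H) :
    Q.dualRight ψ (a * b) = Q.dualRight (Q.dualRight ψ a) b := by
  ext; simp [S_mul, mul_assoc]

theorem dualLeft_dualRight (a b : H) (ψ : Module.Dual k H) :
    Q.dualLeft a (Q.dualRight ψ b) = Q.dualRight (Q.dualLeft a ψ) b := by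
  ext; simp [mul_assoc]

/-- For an algebra `B`, the left action `(a ⊗ b) · (ψ ⊗ c) = (a · ψ) ⊗ b c` of `H ⊗ B` on
`Ĥ ⊗ B`. -/
def actLeft (B : Type v) [Ring B] [Algebra k B] :
    H ⊗[k] B →ₗ[k] Module.Dual k H ⊗[k] B →ₗ[k] Module.Dual k H ⊗[k] B :=
  TensorProduct.map₂ Q.dualLeft (LinearMap.mul k B)

/-- For an algebra `B`, the right action `(ψ ⊗ c) · (a ⊗ b) = (ψ · a) ⊗ c b` of `H ⊗ B` on
`Ĥ ⊗ B`. -/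
def actRight (B : Type v) [Ring B] [Algebra k B] :
    Module.Dual k H ⊗[k] B →ₗ[k] H ⊗[k] B →ₗ[k] Module.Dual k H ⊗[k] B :=
  TensorProduct.map₂ Q.dualRight (LinearMap.mul k B)

@[simp] theorem actLeft_tmul {B : Type v} [Ring B] [Algebra k B] (a : H) (b : B)
    (ψ : Module.Dual k H) (c : B) :
    Q.actLeft B (a ⊗ₜ b) (ψ ⊗ₜ c) = Q.dualLeft a ψ ⊗ₜ (b * c) := rfl

@[simp] theorem actRight_tmul {B : Type v} [Ring B] [Algebra k B] (a : H) (b : B)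
    (ψ : Module.Dual k H) (c : B) :
    Q.actRight B (ψ ⊗ₜ c) (a ⊗ₜ b) = Q.dualRight ψ a ⊗ₜ (c * b) := rfl

/-- `x ⊗ y ↦ ψ(y) x`. -/
def evalSnd (ψ : Module.Dual k H) : H ⊗[k] H →ₗ[k] H :=
  (TensorProduct.rid k H).toLinearMap ∘ₗ LinearMap.lTensor H ψ

@[simp] theorem evalSnd_tmul (ψ : Module.Dual k H) (a b : H) :
    evalSnd ψ (a ⊗ₜ[k] b) = ψ b • a := rfl

section

variable [FiniteDimensional k H]

/-- The definition of `ρ` under the identification `Ĥ ⊗ H ≅ Hom(H, H)`. -/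
theorem dualTensorHom_coaction (ψ : Module.Dual k H) (m : H) :
    dualTensorHom k H H (Q.coaction ψ) m = evalSnd ψ (Q.comulBar m) := by
  have h : dualTensorHomEquiv k H H (Q.coaction ψ) = evalSnd ψ ∘ₗ Q.comulBar := by
    simp only [coaction, LinearMap.comp_apply, LinearEquiv.coe_coe, LinearEquiv.apply_symm_apply]
    rfl
  exact LinearMap.congr_fun h m

theorem dualTensorHom_injective {B : Type v} [AddCommGroup B] [Module k B] :
    Function.Injective (dualTensorHom k H B) :=
  (dualTensorHomEquiv k H B).injective

/-- `ρ(ψ · b) = ρ(ψ) Δ(b)`. -/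
theorem coaction_dualRight (ψ : Module.Dual k H) (b : H) :
    Q.coaction (Q.dualRight ψ b) = Q.actRight H (Q.coaction ψ) (Q.comul b) := by
  apply dualTensorHom_injective
  ext m
  have e1 : ∀ w : H ⊗[k] H, evalSnd (Q.dualRight ψ b) w = evalSnd ψ (w * (1 ⊗ₜ Q.S b)) := by
    intro w
    induction w using tensor_induction with
    | add x y hx hy => simp only [map_add, add_mul, hx, hy]
    | tmul b c => simp
  have e2 : ∀ w, dualTensorHom k H H (Q.actRight H (Q.coaction ψ) w) m = evalSnd ψ
      (sandwich (Q.comulBar ∘ₗ LinearMap.mulLeft k m ∘ₗ Q.S.toLinearMap) inl.toLinearMap 1 w) := by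
    intro w
    induction w using tensor_induction with
    | add x y hx hy => simp only [map_add, LinearMap.add_apply, hx, hy]
    | tmul c d =>
      have e3 : ∀ t : Module.Dual k H ⊗[k] H, dualTensorHom k H H (Q.actRight H t (c ⊗ₜ d)) m =
          dualTensorHom k H H t (m * Q.S c) * d := by
        intro t
        induction t using tensor_induction with
        | add x y hx hy => simp only [map_add, LinearMap.add_apply, add_mul, hx, hy]
        | tmul c d => simp
      have e4 : ∀ w : H ⊗[k] H, evalSnd ψ w * d = evalSnd ψ (w * (d ⊗ₜ 1)) := by
        intro w
        induction w using tensor_induction with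
        | add x y hx hy => simp only [map_add, add_mul, hx, hy]
        | tmul b c => simp
      rw [e3, dualTensorHom_coaction, e4]
      simp
  rw [dualTensorHom_coaction, e1, e2, sandwich_comulBar_right]

/-- `ρ(a · ψ) = Δ(a) ρ(ψ)`. -/
theorem coaction_dualLeft (ψ : Module.Dual k H) (a : H) :
    Q.coaction (Q.dualLeft a ψ) = Q.actLeft H (Q.comul a) (Q.coaction ψ) := by
  apply dualTensorHom_injective
  ext m
  have e1 : ∀ w : H ⊗[k] H, evalSnd (Q.dualLeft a ψ) w = evalSnd ψ ((1 ⊗ₜ Q.S.symm a) * w) := by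
    intro w
    induction w using tensor_induction with
    | add x y hx hy => simp only [map_add, mul_add, hx, hy]
    | tmul b c => simp
  have e2 : ∀ w, dualTensorHom k H H (Q.actLeft H w (Q.coaction ψ)) m = evalSnd ψ
      (sandwich inl.toLinearMap (Q.comulBar ∘ₗ LinearMap.mulRight k m ∘ₗ Q.S.symm.toLinearMap) 1
        (flip w)) := by
    intro w
    induction w using tensor_induction with
    | add x y hx hy => simp only [map_add, LinearMap.add_apply, hx, hy]
    | tmul c d =>
      have e3 : ∀ t : Module.Dual k H ⊗[k] H, dualTensorHom k H H (Q.actLeft H (c ⊗ₜ d) t) m =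
          d * dualTensorHom k H H t (Q.S.symm c * m) := by
        intro t
        induction t using tensor_induction with
        | add x y hx hy => simp only [map_add, LinearMap.add_apply, mul_add, hx, hy]
        | tmul c d => simp
      have e4 : ∀ w : H ⊗[k] H, d * evalSnd ψ w = evalSnd ψ ((d ⊗ₜ 1) * w) := by
        intro w
        induction w using tensor_induction with
        | add x y hx hy => simp only [map_add, mul_add, hx, hy]
        | tmul b c => simp
      rw [e3, dualTensorHom_coaction, e4]
      simp [flip]
  rw [dualTensorHom_coaction, e1, e2, sandwich_comulBar_left]

/-- `(id ⊗ ε) ρ = id`. -/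
theorem counit_coaction (ψ : Module.Dual k H) :
    TensorProduct.rid k (Module.Dual k H)
      (LinearMap.lTensor (Module.Dual k H) Q.counit.toLinearMap (Q.coaction ψ)) = ψ := by
  ext m
  have e1 : ∀ t : Module.Dual k H ⊗[k] H, TensorProduct.rid k (Module.Dual k H)
      (LinearMap.lTensor (Module.Dual k H) Q.counit.toLinearMap t) m =
      Q.counit (dualTensorHom k H H t m) := by
    intro t
    induction t using tensor_induction with
    | add x y hx hy => simp only [map_add, LinearMap.add_apply, hx, hy]
    | tmul c d => simp [mul_comm]
  have e2 : ∀ w : H ⊗[k] H, Q.counit (evalSnd ψ w) = ψ (Q.counitFst H w) := by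
    intro w
    induction w using tensor_induction with
    | add x y hx hy => simp only [map_add, hx, hy]
    | tmul b c => simp [mul_comm]
  rw [e1, dualTensorHom_coaction, e2, counitFst_comulBar]

/-- `(ρ ⊗ id) ρ(ψ) = φ⁻¹ ((id ⊗ Δ) ρ(ψ)) φ`. -/
theorem coaction_coassoc (ψ : Module.Dual k H) :
    TensorProduct.assoc k (Module.Dual k H) H H (LinearMap.rTensor H Q.coaction (Q.coaction ψ)) =
      Q.actLeft (H ⊗[k] H) Q.phi.inv (Q.actRight (H ⊗[k] H)
        (LinearMap.lTensor (Module.Dual k H) Q.comul.toLinearMap (Q.coaction ψ)) Q.phi.val) := by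
  apply dualTensorHom_injective
  ext m
  have e1 : ∀ t : Module.Dual k H ⊗[k] H, dualTensorHom k H (H ⊗[k] H)
      (TensorProduct.assoc k (Module.Dual k H) H H (LinearMap.rTensor H Q.coaction t)) m =
      LinearMap.lTensor H (dualTensorHom k H H t) (Q.comulBar m) := by
    intro t
    induction t using tensor_induction with
    | add x y hx hy => simp only [map_add, LinearMap.add_apply, LinearMap.lTensor_add, hx, hy]
    | tmul χ h =>
      have e : ∀ s : Module.Dual k H ⊗[k] H, dualTensorHom k H (H ⊗[k] H)
          (TensorProduct.assoc k (Module.Dual k H) H H (s ⊗ₜ h)) m =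
          dualTensorHom k H H s m ⊗ₜ h := by
        intro s
        induction s using tensor_induction with
        | add x y hx hy => simp only [map_add, LinearMap.add_apply, TensorProduct.add_tmul, hx, hy]
        | tmul c d => simp [TensorProduct.smul_tmul']
      rw [LinearMap.rTensor_tmul, e, dualTensorHom_coaction]
      induction Q.comulBar m using tensor_induction with
      | add x y hx hy => simp only [map_add, TensorProduct.add_tmul, hx, hy]
      | tmul c d => simp [TensorProduct.smul_tmul]
  have e1' : dualTensorHom k H H (Q.coaction ψ) = evalSnd ψ ∘ₗ Q.comulBar :=
    LinearMap.ext (Q.dualTensorHom_coaction ψ)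
  have e2 : ∀ w y : H ⊗[k] (H ⊗[k] H), dualTensorHom k H (H ⊗[k] H)
      (Q.actLeft (H ⊗[k] H) w (Q.actRight (H ⊗[k] H)
        (LinearMap.lTensor (Module.Dual k H) Q.comul.toLinearMap (Q.coaction ψ)) y)) m =
      LinearMap.lTensor H (evalSnd ψ)
        (sandwich (tensorOne (k := k) H H H).toLinearMap
          (Q.comul₃.toLinearMap ∘ₗ Q.S.symm.toLinearMap)
          (Q.comulFst H Q.V) (TensorProduct.comm k H (H ⊗[k] H) w) *
        (Q.comul₃ m *
        sandwich (Q.comul₃.toLinearMap ∘ₗ Q.S.toLinearMap) (tensorOne (k := k) H H H).toLinearMap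
          (Q.comulFst H Q.U) y)) := by
    intro w y
    induction w using tensor_induction with
    | add x y hx hy => simp only [map_add, LinearMap.add_apply, add_mul, hx, hy]
    | tmul a w =>
      induction y using tensor_induction with
      | add x y hx hy => simp only [map_add, LinearMap.add_apply, mul_add, hx, hy]
      | tmul b y =>
        have h2 : ∀ x : H ⊗[k] H, w * (Q.comul (evalSnd ψ x) * y) =
            LinearMap.lTensor H (evalSnd ψ)
              (tensorOne H H H w * (Q.comulFst H x * tensorOne H H H y)) := by
          intro x
          induction x using tensor_induction with
          | add x y hx hy => simp only [map_add, mul_add, add_mul, hx, hy]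
          | tmul c d =>
            rw [evalSnd_tmul, map_smul, comulFst_tmul]
            induction Q.comul c using tensor_induction with
            | add x y hx hy =>
              simp only [map_add, TensorProduct.add_tmul, smul_add, mul_add, add_mul, hx, hy]
            | tmul c₁ c₂ =>
              induction w using tensor_induction with
              | add x y hx hy => simp only [map_add, add_mul, hx, hy]
              | tmul w₁ w₂ =>
                induction y using tensor_induction with
                | add x y hx hy => simp only [map_add, mul_add, hx, hy]
                | tmul y₁ y₂ => simp
        have h1 : ∀ t : Module.Dual k H ⊗[k] H, dualTensorHom k H (H ⊗[k] H)
            (Q.actLeft (H ⊗[k] H) (a ⊗ₜ w) (Q.actRight (H ⊗[k] H)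
              (LinearMap.lTensor (Module.Dual k H) Q.comul.toLinearMap t) (b ⊗ₜ y))) m =
            w * (Q.comul (dualTensorHom k H H t (Q.S.symm a * m * Q.S b)) * y) := by
          intro t
          induction t using tensor_induction with
          | add x y hx hy => simp only [map_add, LinearMap.add_apply, mul_add, add_mul, hx, hy]
          | tmul c d => simp
        rw [h1, dualTensorHom_coaction, h2]
        simp [comulBar_apply, comul₃_apply, mul_assoc]
  rw [e1, e1', LinearMap.lTensor_comp_apply, lTensor_comulBar, e2]

end

/-! ### The structure theorem for the dual -/

theorem actLeft_one {B : Type v} [Ring B] [Algebra k B] (t : Module.Dual k H ⊗[k] B) :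
    Q.actLeft B 1 t = t := by
  induction t using tensor_induction with
  | add x y hx hy => simp only [map_add, hx, hy]
  | tmul ψ b => simp [Algebra.TensorProduct.one_def, dualLeft_one]

theorem actLeft_mul {B : Type v} [Ring B] [Algebra k B] (x y : H ⊗[k] B)
    (t : Module.Dual k H ⊗[k] B) :
    Q.actLeft B (x * y) t = Q.actLeft B x (Q.actLeft B y t) := by
  induction t using tensor_induction with
  | add s t hs ht => simp only [map_add, hs, ht]
  | tmul ψ b =>
    induction x using tensor_induction with
    | add s t hs ht => simp only [map_add, add_mul, LinearMap.add_apply, hs, ht]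
    | tmul c d =>
      induction y using tensor_induction with
      | add s t hs ht => simp only [map_add, mul_add, LinearMap.add_apply, hs, ht]
      | tmul e f => simp [dualLeft_mul, mul_assoc]

theorem actLeft_actRight {B : Type v} [Ring B] [Algebra k B] (x y : H ⊗[k] B)
    (t : Module.Dual k H ⊗[k] B) :
    Q.actLeft B x (Q.actRight B t y) = Q.actRight B (Q.actLeft B x t) y := by
  induction t using tensor_induction with
  | add s t hs ht => simp only [map_add, LinearMap.add_apply, hs, ht]
  | tmul ψ b =>
    induction x using tensor_induction with
    | add s t hs ht => simp only [map_add, LinearMap.add_apply, hs, ht]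
    | tmul c d =>
      induction y using tensor_induction with
      | add s t hs ht => simp only [map_add, hs, ht]
      | tmul e f => simp [dualLeft_dualRight, mul_assoc]

theorem lTensor_actLeft {B C : Type v} [Ring B] [Algebra k B] [Ring C] [Algebra k C] (g : B →ₐ[k] C)
    (x : H ⊗[k] B) (t : Module.Dual k H ⊗[k] B) :
    LinearMap.lTensor (Module.Dual k H) g.toLinearMap (Q.actLeft B x t) =
      Q.actLeft C (idTensor H g x) (LinearMap.lTensor (Module.Dual k H) g.toLinearMap t) := by
  induction t using tensor_induction with
  | add s t hs ht => simp only [map_add, hs, ht]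
  | tmul ψ b =>
    induction x using tensor_induction with
    | add s t hs ht => simp only [map_add, LinearMap.add_apply, hs, ht]
    | tmul c d => simp

theorem lTensor_actRight {B C : Type v} [Ring B] [Algebra k B] [Ring C] [Algebra k C]
    (g : B →ₐ[k] C) (t : Module.Dual k H ⊗[k] B) (x : H ⊗[k] B) :
    LinearMap.lTensor (Module.Dual k H) g.toLinearMap (Q.actRight B t x) =
      Q.actRight C (LinearMap.lTensor (Module.Dual k H) g.toLinearMap t) (idTensor H g x) := by
  induction t using tensor_induction with
  | add s t hs ht => simp only [map_add, LinearMap.add_apply, hs, ht]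
  | tmul ψ b =>
    induction x using tensor_induction with
    | add s t hs ht => simp only [map_add, hs, ht]
    | tmul c d => simp

/-- `ψ ⊗ x ⊗ y ↦ ψ · (β S(x) α y)`. -/
def contractRight : Module.Dual k H ⊗[k] (H ⊗[k] H) →ₗ[k] Module.Dual k H :=
  TensorProduct.lift Q.dualRight ∘ₗ
    LinearMap.lTensor (Module.Dual k H) (LinearMap.mulLeft k Q.beta ∘ₗ Q.contractAlpha)

@[simp] theorem contractRight_tmul (ψ : Module.Dual k H) (w : H ⊗[k] H) :
    Q.contractRight (ψ ⊗ₜ w) = Q.dualRight ψ (Q.beta * Q.contractAlpha w) := rfl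

/-- `contractRight` sends `((id ⊗ Δ) t) · y` to `(id ⊗ ε)(t) · zigzag(y)`. -/
theorem contractRight_actRight (t : Module.Dual k H ⊗[k] H) (y : H ⊗[k] (H ⊗[k] H)) :
    Q.contractRight (Q.actRight (H ⊗[k] H)
      (LinearMap.lTensor (Module.Dual k H) Q.comul.toLinearMap t) y) =
    Q.dualRight (TensorProduct.rid k (Module.Dual k H)
      (LinearMap.lTensor (Module.Dual k H) Q.counit.toLinearMap t)) (Q.zigzag y) := by
  induction t using tensor_induction with
  | add s t hs ht => simp only [map_add, LinearMap.add_apply, hs, ht]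
  | tmul ψ h =>
    induction y using tensor_induction with
    | add s t hs ht => simp only [map_add, hs, ht]
    | tmul c v => simp [zigzag_tmul, contractAlpha_comul_mul, ← dualRight_mul, mul_assoc]

section

variable [FiniteDimensional k H]

/-- `E(ψ) = X · ψ₀ · (β S(Y ψ₁) α Z)`, where `φ = X ⊗ Y ⊗ Z`. -/
theorem E_apply (ψ : Module.Dual k H) :
    Q.E ψ = Q.contractRight (Q.actLeft (H ⊗[k] H) Q.phi.val
      (LinearMap.lTensor (Module.Dual k H) inl.toLinearMap (Q.coaction ψ))) := by
  have e : ∀ x t, (TensorProduct.lift Q.dualRight ∘ₗ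
      TensorProduct.map (TensorProduct.lift Q.dualLeft)
        (LinearMap.mulLeft k Q.beta ∘ₗ Q.S.toLinearMap ∘ₗ LinearMap.mul' k H) ∘ₗ
      (TensorProduct.tensorTensorTensorComm k H H (Module.Dual k H) H).toLinearMap ∘ₗ
      TensorProduct.mk k (H ⊗[k] H) (Module.Dual k H ⊗[k] H)
        (TensorProduct.map LinearMap.id
          (LinearMap.mul' k H ∘ₗ
            TensorProduct.map (Q.S.symm.toLinearMap ∘ₗ LinearMap.mulLeft k Q.alpha) LinearMap.id ∘ₗ
            (flip : H ⊗[k] H ≃ₗ[k] H ⊗[k] H).toLinearMap) x)) t =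
      Q.contractRight (Q.actLeft (H ⊗[k] H) x
        (LinearMap.lTensor (Module.Dual k H) inl.toLinearMap t)) := by
    intro x t
    induction x using tensor_induction₃ with
    | add x y hx hy =>
      simp only [map_add, LinearMap.add_apply, LinearMap.comp_add, hx, hy]
    | tmul a b c =>
      induction t using tensor_induction with
      | add s t hs ht => simp only [map_add, hs, ht]
      | tmul ψ d => simp [flip, S_mul, mul_assoc]
  exact e Q.phi.val (Q.coaction ψ)

/-- `E(ψ · b) = ε(b) E(ψ)`. -/
theorem E_dualRight (ψ : Module.Dual k H) (b : H) :
    Q.E (Q.dualRight ψ b) = Q.counit b • Q.E ψ := by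
  rw [E_apply, E_apply, coaction_dualRight]
  induction Q.phi.val using tensor_induction with
  | add x y hx hy => simp only [map_add, LinearMap.add_apply, smul_add, hx, hy]
  | tmul X v =>
    induction Q.coaction ψ using tensor_induction with
    | add x y hx hy => simp only [map_add, LinearMap.add_apply, smul_add, hx, hy]
    | tmul χ h =>
      have e : ∀ w, Q.contractRight (Q.actLeft (H ⊗[k] H) (X ⊗ₜ v)
          (LinearMap.lTensor (Module.Dual k H) inl.toLinearMap (Q.actRight H (χ ⊗ₜ h) w))) =
          Q.dualRight (Q.dualLeft X χ) (Q.contractBeta w * Q.contractAlpha (v * (h ⊗ₜ 1))) := by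
        intro w
        induction w using tensor_induction with
        | add x y hx hy => simp only [map_add, add_mul, hx, hy]
        | tmul c d =>
          simp only [actRight_tmul, LinearMap.lTensor_tmul, AlgHom.toLinearMap_apply, map_mul,
            actLeft_tmul, contractRight_tmul, contractBeta_tmul, dualLeft_dualRight]
          rw [← mul_assoc v, Algebra.TensorProduct.includeLeft_apply d, contractAlpha_tmul_mul,
            mul_one, ← dualRight_mul]
          simp only [Algebra.TensorProduct.includeLeft_apply, mul_assoc]
      rw [e, contractBeta_comul]
      simp

/-- `E(ψ₀) · ψ₁ = ψ`. -/
theorem E_coaction (ψ : Module.Dual k H) :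
    TensorProduct.lift Q.dualRight (LinearMap.rTensor H Q.E (Q.coaction ψ)) = ψ := by
  have e : ∀ t, TensorProduct.lift Q.dualRight (LinearMap.rTensor H Q.E t) =
      Q.contractRight (Q.actLeft (H ⊗[k] H) Q.phi.val
        (TensorProduct.assoc k (Module.Dual k H) H H (LinearMap.rTensor H Q.coaction t))) := by
    intro t
    induction t using tensor_induction with
    | add s t hs ht => simp only [map_add, hs, ht]
    | tmul χ h =>
      rw [LinearMap.rTensor_tmul, LinearMap.rTensor_tmul, TensorProduct.lift.tmul, E_apply]
      induction Q.coaction χ using tensor_induction with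
      | add s t hs ht => simp only [map_add, TensorProduct.add_tmul, LinearMap.add_apply, hs, ht]
      | tmul ξ d =>
        induction Q.phi.val using tensor_induction with
        | add s t hs ht => simp only [map_add, LinearMap.add_apply, hs, ht]
        | tmul X v => simp [contractAlpha_tmul_mul, ← dualRight_mul, mul_assoc]
  rw [e, coaction_coassoc, ← actLeft_mul, phi_mul_inv, actLeft_one, contractRight_actRight,
    counit_coaction, zigzag_phi, dualRight_one]

/-- `E(a · ψ · c) ⊗ b d = E(a · ψ) ⊗ b (ε(c) d)`. -/
theorem rTensor_E_actRight {B : Type v} [Ring B] [Algebra k B] (a : H) (x : H ⊗[k] B)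
    (t : Module.Dual k H ⊗[k] B) :
    LinearMap.rTensor B (Q.E ∘ₗ Q.dualLeft a) (Q.actRight B t x) =
      LinearMap.lTensor (Module.Dual k H) (LinearMap.mulRight k (Q.counitFst B x))
        (LinearMap.rTensor B (Q.E ∘ₗ Q.dualLeft a) t) := by
  induction t using tensor_induction with
  | add s t hs ht => simp only [map_add, LinearMap.add_apply, hs, ht]
  | tmul ψ b =>
    induction x using tensor_induction with
    | add s t hs ht =>
      simp only [map_add, hs, ht]
      simp [mul_add, TensorProduct.tmul_add]
    | tmul c d => simp [dualLeft_dualRight, E_dualRight, TensorProduct.smul_tmul]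

/-- `E(a · E(ψ)₀) ⊗ E(ψ)₁ = E(a · ψ) ⊗ 1`. The left-hand side contracts
`(Δ ⊗ id ⊗ id)(φ) · (ψ₀₀ ⊗ ψ₀₁ ⊗ ψ₁ ⊗ 1)`; coassociativity of `ρ` replaces `ψ₀₀ ⊗ ψ₀₁ ⊗ ψ₁` by
`φ⁻¹ · (ψ₀ ⊗ Δ(ψ₁)) · φ`, and `lTensor_zigzag_comulFst` evaluates what is left. -/
theorem rTensor_coaction_E (a : H) (ψ : Module.Dual k H) :
    LinearMap.rTensor H (Q.E ∘ₗ Q.dualLeft a) (Q.coaction (Q.E ψ)) =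
      Q.E (Q.dualLeft a ψ) ⊗ₜ 1 := by
  have e1 : ∀ x t, LinearMap.rTensor H (Q.E ∘ₗ Q.dualLeft a) (Q.coaction
      (Q.contractRight (Q.actLeft (H ⊗[k] H) x
        (LinearMap.lTensor (Module.Dual k H) inl.toLinearMap t)))) =
      TensorProduct.map (Q.E ∘ₗ Q.dualLeft a) Q.zigzag
        (Q.actLeft (H ⊗[k] (H ⊗[k] H)) (Q.comulFst (H ⊗[k] H) x)
          (LinearMap.lTensor (Module.Dual k H) (tensorOne (k := k) H H H).toLinearMap
            (TensorProduct.assoc k (Module.Dual k H) H H (LinearMap.rTensor H Q.coaction t)))) := by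
    intro x t
    induction x using tensor_induction with
    | add x y hx hy => simp only [map_add, LinearMap.add_apply, hx, hy]
    | tmul X v =>
      induction t using tensor_induction with
      | add s t hs ht => simp only [map_add, hs, ht]
      | tmul χ h =>
        have l : Q.coaction (Q.contractRight (Q.actLeft (H ⊗[k] H) (X ⊗ₜ v)
            (LinearMap.lTensor (Module.Dual k H) inl.toLinearMap (χ ⊗ₜ h)))) =
            Q.actRight H (Q.actLeft H (Q.comul X) (Q.coaction χ))
              (Q.comul (Q.beta * Q.contractAlpha (v * (h ⊗ₜ 1)))) := by
          simp [coaction_dualRight, coaction_dualLeft]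
        rw [l, rTensor_E_actRight, counitFst_comul, LinearMap.rTensor_tmul, comulFst_tmul]
        induction Q.coaction χ using tensor_induction with
        | add s t hs ht => simp only [map_add, TensorProduct.add_tmul, hs, ht]
        | tmul ξ d =>
          induction Q.comul X using tensor_induction with
          | add s t hs ht =>
            simp only [map_add, LinearMap.add_apply, TensorProduct.add_tmul, hs, ht]
          | tmul X₁ X₂ => simp [zigzag_tmul, mul_assoc]
  have e2 : ∀ (x : H ⊗[k] (H ⊗[k] (H ⊗[k] H))) t, TensorProduct.map (Q.E ∘ₗ Q.dualLeft a) Q.zigzag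
      (Q.actLeft _ x (LinearMap.lTensor (Module.Dual k H) (tensorOne (k := k) H H H).toLinearMap
        (LinearMap.lTensor (Module.Dual k H) Q.comul.toLinearMap t))) =
      LinearMap.rTensor H (Q.E ∘ₗ Q.dualLeft a ∘ₗ Q.dualLeft.flip
        (TensorProduct.rid k (Module.Dual k H)
          (LinearMap.lTensor (Module.Dual k H) Q.counit.toLinearMap t)))
        (LinearMap.lTensor H Q.zigzag x) := by
    intro x t
    induction t using tensor_induction with
    | add s t hs ht =>
      simp only [map_add, LinearMap.comp_add, LinearMap.rTensor_add, LinearMap.add_apply, hs, ht]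
    | tmul χ h =>
      induction x using tensor_induction with
      | add x y hx hy => simp only [map_add, LinearMap.add_apply, hx, hy]
      | tmul b v =>
        simp [← comulFst_tmul_one, zigzag_mul_comulFst, TensorProduct.smul_tmul]
  rw [E_apply, e1, coaction_coassoc, lTensor_actLeft, lTensor_actRight, ← actLeft_mul,
    actLeft_actRight, ← LinearMap.lTensor_comp_rTensor, LinearMap.comp_apply, rTensor_E_actRight]
  have e3 : Q.counitFst (H ⊗[k] (H ⊗[k] H)) (idTensor H (tensorOne H H H) Q.phi.val) = 1 := by
    have : ∀ x : H ⊗[k] (H ⊗[k] H), Q.counitFst (H ⊗[k] (H ⊗[k] H))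
        (idTensor H (tensorOne H H H) x) = tensorOne H H H (Q.counitFst (H ⊗[k] H) x) := by
      intro x
      induction x using tensor_induction with
      | add x y hx hy => simp only [map_add, hx, hy]
      | tmul b c => simp
    rw [this, counitFst_phi, map_one]
  rw [e3, LinearMap.mulRight_one, LinearMap.lTensor_id, LinearMap.id_apply,
    ← LinearMap.comp_apply, LinearMap.lTensor_comp_rTensor, e2, lTensor_zigzag_comulFst,
    counit_coaction]
  simp [Algebra.TensorProduct.one_def, dualLeft_one]

/-- `E(a · E(ψ)) = E(a · ψ)`, by applying `id ⊗ ε` to `rTensor_coaction_E`. -/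
theorem E_dualLeft_E (a : H) (ψ : Module.Dual k H) :
    Q.E (Q.dualLeft a (Q.E ψ)) = Q.E (Q.dualLeft a ψ) := by
  have e : ∀ t, TensorProduct.rid k (Module.Dual k H)
      (LinearMap.lTensor (Module.Dual k H) Q.counit.toLinearMap
        (LinearMap.rTensor H (Q.E ∘ₗ Q.dualLeft a) t)) =
      Q.E (Q.dualLeft a (TensorProduct.rid k (Module.Dual k H)
        (LinearMap.lTensor (Module.Dual k H) Q.counit.toLinearMap t))) := by
    intro t
    induction t using tensor_induction with
    | add s t hs ht => simp only [map_add, hs, ht]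
    | tmul χ h => simp
  have h := e (Q.coaction (Q.E ψ))
  rw [counit_coaction, rTensor_coaction_E] at h
  simpa using h.symm

theorem E_E (ψ : Module.Dual k H) : Q.E (Q.E ψ) = Q.E ψ := by
  simpa only [dualLeft_one] using Q.E_dualLeft_E 1 ψ

/-- `a · E(ψ) = E(a₁ · ψ) · a₂`. -/
theorem dualLeft_E (a : H) (ψ : Module.Dual k H) :
    Q.dualLeft a (Q.E ψ) = TensorProduct.lift Q.dualRight
      (LinearMap.rTensor H (Q.E ∘ₗ Q.dualLeft.flip ψ) (Q.comul a)) := by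
  have e : ∀ w, LinearMap.rTensor H Q.E (Q.actLeft H w (Q.coaction (Q.E ψ))) =
      LinearMap.rTensor H (Q.E ∘ₗ Q.dualLeft.flip ψ) w := by
    intro w
    induction w using tensor_induction with
    | add s t hs ht => simp only [map_add, LinearMap.add_apply, hs, ht]
    | tmul c d =>
      have e' : ∀ t, LinearMap.rTensor H Q.E (Q.actLeft H (c ⊗ₜ d) t) =
          LinearMap.lTensor (Module.Dual k H) (LinearMap.mulLeft k d)
            (LinearMap.rTensor H (Q.E ∘ₗ Q.dualLeft c) t) := by
        intro t
        induction t using tensor_induction with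
        | add s t hs ht => simp only [map_add, hs, ht]
        | tmul χ h => simp
      rw [e', rTensor_coaction_E]
      simp
  rw [← e, ← coaction_dualLeft, E_coaction]

/-- `E((E(ψ) · a)₀) ⊗ (E(ψ) · a)₁ = E(ψ) ⊗ a`. -/
theorem rTensor_E_coaction (ψ : Module.Dual k H) (a : H) :
    LinearMap.rTensor H Q.E (Q.coaction (Q.dualRight (Q.E ψ) a)) = Q.E ψ ⊗ₜ a := by
  have h1 : Q.E ∘ₗ Q.dualLeft 1 = Q.E := LinearMap.ext fun χ => by
    rw [LinearMap.comp_apply, dualLeft_one]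
  have h2 := Q.rTensor_E_actRight 1 (Q.comul a) (Q.coaction (Q.E ψ))
  rw [rTensor_coaction_E, h1, counitFst_comul, dualLeft_one] at h2
  rw [coaction_dualRight, h2]
  simp

end

end QuasiHopfAlgebra

/-! ### Nondegenerate functionals -/

section Frobenius

variable {k : Type u} {H : Type v} [Field k] [Ring H] [Algebra k H]

theorem modularAut_spec [FiniteDimensional k H] (ω : Module.Dual k H)
    (hω : IsNondegenerateFunctional ω) (a b : H) : ω (b * modularAut ω hω a) = ω (a * b) :=
  modularLinear_spec ω hω a b

/-- In finite dimension one-sided nondegeneracy suffices. -/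
theorem isNondegenerateFunctional_of_rightForm_injective [FiniteDimensional k H]
    {ω : Module.Dual k H} (h : Function.Injective (rightForm ω)) : IsNondegenerateFunctional ω := by
  have hs : Function.Surjective (rightForm ω) :=
    (LinearMap.injective_iff_surjective_of_finrank_eq_finrank
      Subspace.dual_finrank_eq.symm).mp h
  refine ⟨?_, LinearMap.separatingRight_iff_flip_ker_eq_bot.mpr (LinearMap.ker_eq_bot.mpr h)⟩
  intro x hx
  rw [← Module.forall_dual_apply_eq_zero_iff k]
  intro ψ
  obtain ⟨c, rfl⟩ := hs ψ
  exact hx c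

/-- Two nondegenerate functionals `ω`, `ω' = ω(- u)` have `u θ_ω(a) = θ_ω'(a) u`, so a character
composed with `θ_ω⁻¹` does not depend on `ω`. -/
theorem comp_modularAut_symm_eq [FiniteDimensional k H] (χ : H →ₐ[k] k) (ω ω' : Module.Dual k H)
    (hω : IsNondegenerateFunctional ω) (hω' : IsNondegenerateFunctional ω') :
    χ.comp (modularAut ω hω).symm.toAlgHom = χ.comp (modularAut ω' hω').symm.toAlgHom := by
  obtain ⟨u, hu⟩ := (rightFormEquiv ω hω).surjective ω'
  obtain ⟨v, hv⟩ := (rightFormEquiv ω' hω').surjective ω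
  have hu' : ∀ b, ω (b * u) = ω' b := fun b => LinearMap.congr_fun hu b
  have hv' : ∀ b, ω' (b * v) = ω b := fun b => LinearMap.congr_fun hv b
  have hvu : v * u = 1 := by
    apply rightForm_injective hω
    ext b
    simp [← mul_assoc, hu', hv']
  set θ := modularAut ω hω
  set θ' := modularAut ω' hω'
  have hθ : ∀ a, u * θ a = θ' a * u := by
    intro a
    apply rightForm_injective hω
    ext b
    simp only [rightForm_apply, ← mul_assoc, hu', θ, θ', modularAut_spec]
  set η := χ.comp θ'.symm.toAlgHom with hη
  have hη' : ∀ a, η (θ' a) = χ a := by simp [hη]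
  have hu0 : η u ≠ 0 := by
    intro h
    simpa [h] using congrArg η hvu
  apply AlgHom.ext
  intro x
  obtain ⟨a, rfl⟩ := θ.surjective x
  have h := congrArg η (hθ a)
  rw [map_mul, map_mul, hη', mul_comm] at h
  simpa using (mul_right_cancel₀ hu0 h).symm

end Frobenius

namespace QuasiHopfAlgebra

variable {k : Type u} {H : Type v} [Field k] [Ring H] [Algebra k H] (Q : QuasiHopfAlgebra k H)

/-! ### Characters and the antipode -/

/-- A character does not vanish on `β`, as `X β S(Y) α Z = 1`. -/
theorem character_beta_ne_zero (χ : H →ₐ[k] k) : χ Q.beta ≠ 0 := by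
  intro h
  have e : ∀ x, χ (Q.zigzag x) = 0 := by
    intro x
    induction x using tensor_induction with
    | add x y hx hy => simp only [map_add, hx, hy, add_zero]
    | tmul a w => simp [zigzag_tmul, h]
  simpa [zigzag_phi] using e Q.phi.val

/-- `χ(S(a ↼ χ)) = ε(a)` for a character `χ`. -/
theorem character_S_hit (χ : H →ₐ[k] k) (a : H) :
    χ (Q.S (Q.hit a χ.toLinearMap)) = Q.counit a := by
  have e : ∀ w : H ⊗[k] H, χ (Q.contractBeta w) =
      χ (Q.S (TensorProduct.lid k H (TensorProduct.map χ.toLinearMap LinearMap.id w))) *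
        χ Q.beta := by
    intro w
    induction w using tensor_induction with
    | add x y hx hy => simp only [map_add, add_mul, hx, hy]
    | tmul a w => simp; ring
  apply mul_right_cancel₀ (Q.character_beta_ne_zero χ)
  rw [hit, ← e, contractBeta_comul, map_smul, smul_eq_mul]

theorem hit_counit (a : H) : Q.hit a Q.counit.toLinearMap = a := Q.counit_left a

theorem counit_hit (a : H) (χ : Module.Dual k H) : Q.counit (Q.hit a χ) = χ a := by
  have e : ∀ w : H ⊗[k] H, Q.counit (TensorProduct.lid k H (TensorProduct.map χ LinearMap.id w)) =
      χ (Q.counitSnd H w) := by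
    intro w
    induction w using tensor_induction with
    | add x y hx hy => simp only [map_add, hx, hy]
    | tmul a w => simp [mul_comm]
  rw [hit, e, counitSnd_comul]

theorem counit_S (a : H) : Q.counit (Q.S a) = Q.counit a := by
  simpa only [hit_counit] using Q.character_S_hit Q.counit a

/-! ### Left cointegrals -/

section

variable [FiniteDimensional k H]

theorem E_of_mem {lam : Module.Dual k H} (h : lam ∈ Q.leftCointegrals) : Q.E lam = lam := by
  obtain ⟨ψ, rfl⟩ := h
  exact Q.E_E ψ

/-- `E(ψ₀) · ψ₁ = ψ` would force `Ĥ = 0` if `E` vanished. -/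
theorem exists_mem_leftCointegrals_ne_zero : ∃ lam ∈ Q.leftCointegrals, lam ≠ 0 := by
  by_contra! h
  have hE : Q.E = 0 := LinearMap.ext fun ψ => h _ ⟨ψ, rfl⟩
  have h1 := Q.E_coaction Q.counit.toLinearMap
  rw [hE, LinearMap.rTensor_zero] at h1
  simpa using LinearMap.congr_fun h1 1

/-- `a ↦ λ · a` is injective for a nonzero cointegral `λ`: the tensor `λ ⊗ a` depends
only on `λ · a`. -/
theorem dualRight_injective {lam : Module.Dual k H} (h : lam ∈ Q.leftCointegrals) (h0 : lam ≠ 0) :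
    Function.Injective (Q.dualRight lam) := by
  rw [← LinearMap.ker_eq_bot, LinearMap.ker_eq_bot']
  intro a ha
  obtain ⟨m, hm⟩ := DFunLike.ne_iff.mp h0
  obtain ⟨ψ, rfl⟩ := h
  have h1 := Q.rTensor_E_coaction ψ a
  rw [ha, map_zero, map_zero] at h1
  -- Contracting `0 = lam ⊗ a` with `m` in the first factor gives `lam m • a = 0`.
  have h2 := congrArg (fun t => TensorProduct.lid k H
    (LinearMap.rTensor H (Module.Dual.eval k H m) t)) h1.symm
  have h3 : Q.E ψ m • a = 0 := by simpa using h2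
  exact (smul_eq_zero.mp h3).resolve_left hm

theorem isNondegenerate_of_mem {lam : Module.Dual k H} (h : lam ∈ Q.leftCointegrals)
    (h0 : lam ≠ 0) : IsNondegenerateFunctional lam := by
  apply isNondegenerateFunctional_of_rightForm_injective
  intro x y hxy
  apply Q.S.symm.injective
  apply Q.dualRight_injective h h0
  ext b
  simpa using LinearMap.congr_fun hxy b

/-- Cointegrals are unique up to scalars. -/
theorem exists_smul_eq {lam lam' : Module.Dual k H} (h : lam ∈ Q.leftCointegrals) (h0 : lam ≠ 0)
    (h' : lam' ∈ Q.leftCointegrals) : ∃ c : k, lam' = c • lam := by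
  have hs : Function.Surjective (Q.dualRight lam) :=
    (LinearMap.injective_iff_surjective_of_finrank_eq_finrank
      Subspace.dual_finrank_eq.symm).mp (Q.dualRight_injective h h0)
  obtain ⟨a, rfl⟩ := hs lam'
  exact ⟨Q.counit a, by rw [← Q.E_of_mem h', E_dualRight, E_of_mem Q h]⟩

/-- `H` acts on the line of cointegrals by a unique character. -/
theorem existsUnique_actsOnCointegralsBy : ∃! γ : H →ₐ[k] k, Q.ActsOnCointegralsBy γ := by
  obtain ⟨lam, h, h0⟩ := Q.exists_mem_leftCointegrals_ne_zero
  have hc : ∀ a, ∃ c : k, Q.E (Q.dualLeft a lam) = c • lam := fun a =>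
    Q.exists_smul_eq h h0 ⟨_, rfl⟩
  choose g hg using hc
  have inj : ∀ {c d : k}, c • lam = d • lam → c = d := fun e => smul_left_injective k h0 e
  let γ : H →ₐ[k] k := AlgHom.ofLinearMap
    { toFun := g
      map_add' := fun a b => inj (by
        rw [← hg, map_add, LinearMap.add_apply, map_add, hg, hg, add_smul])
      map_smul' := fun c a => inj (by
        rw [← hg, map_smul, LinearMap.smul_apply, map_smul, hg, RingHom.id_apply, smul_assoc]) }
    (inj (by
      change g 1 • lam = _
      rw [← hg, dualLeft_one, E_of_mem Q h, one_smul]))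
    (fun a b => inj (by
      change g (a * b) • lam = (g a * g b) • lam
      rw [← hg, dualLeft_mul, ← E_dualLeft_E, hg, map_smul, map_smul, hg, smul_smul, mul_comm]))
  refine ⟨γ, ?_, ?_⟩
  · intro a lam' h'
    obtain ⟨c, rfl⟩ := Q.exists_smul_eq h h0 h'
    rw [map_smul, map_smul, hg, smul_comm]
    rfl
  · intro γ' hγ'
    ext a
    exact inj ((hγ' a lam h).symm.trans (hg a))

/-- `a · λ = λ · (a ↼ γ)` for a cointegral `λ`. -/
theorem dualLeft_of_mem {γ : H →ₐ[k] k} (hγ : Q.ActsOnCointegralsBy γ) {lam : Module.Dual k H}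
    (h : lam ∈ Q.leftCointegrals) (a : H) :
    Q.dualLeft a lam = Q.dualRight lam (Q.hit a γ.toLinearMap) := by
  have e : ∀ w : H ⊗[k] H, TensorProduct.lift Q.dualRight
      (LinearMap.rTensor H (Q.E ∘ₗ Q.dualLeft.flip lam) w) =
      Q.dualRight lam
        (TensorProduct.lid k H (TensorProduct.map γ.toLinearMap LinearMap.id w)) := by
    intro w
    induction w using tensor_induction with
    | add x y hx hy => simp only [map_add, hx, hy]
    | tmul a b => simp [hγ a lam h]
  have h1 := Q.dualLeft_E a lam
  rwa [E_of_mem Q h, e] at h1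

/-- `θ_λ(a) = S(S(a) ↼ γ)`, from `S(a) · λ = λ · (S(a) ↼ γ)`. -/
theorem modularAut_of_mem {γ : H →ₐ[k] k} (hγ : Q.ActsOnCointegralsBy γ) {lam : Module.Dual k H}
    (h : lam ∈ Q.leftCointegrals) (hlam : IsNondegenerateFunctional lam) (a : H) :
    modularAut lam hlam a = Q.S (Q.hit (Q.S a) γ.toLinearMap) := by
  apply rightForm_injective hlam
  ext b
  have h1 := LinearMap.congr_fun (Q.dualLeft_of_mem hγ h (Q.S a)) b
  simpa [modularAut_spec] using h1

/-- `γ = ε ∘ θ_λ⁻¹`, since `γ(θ_λ(a)) = γ(S(S(a) ↼ γ)) = ε(S(a)) = ε(a)`. -/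
theorem eq_counit_comp_modularAut_symm {γ : H →ₐ[k] k} (hγ : Q.ActsOnCointegralsBy γ)
    {lam : Module.Dual k H} (h : lam ∈ Q.leftCointegrals) (hlam : IsNondegenerateFunctional lam) :
    γ = Q.counit.comp (modularAut lam hlam).symm.toAlgHom := by
  ext x
  obtain ⟨a, rfl⟩ := (modularAut lam hlam).surjective x
  change γ (modularAut lam hlam a) =
    Q.counit ((modularAut lam hlam).symm (modularAut lam hlam a))
  rw [AlgEquiv.symm_apply_apply, Q.modularAut_of_mem hγ h hlam a, character_S_hit, counit_S]

theorem eq_of_isModulus {μ μ' : H →ₐ[k] k} (h : Q.IsModulus μ) (h' : Q.IsModulus μ') : μ = μ' := by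
  obtain ⟨ω, hω, rfl⟩ := h
  obtain ⟨ω', hω', rfl⟩ := h'
  exact comp_modularAut_symm_eq _ _ _ _ _

end

end QuasiHopfAlgebra

end

theorem lemma5p1 {k : Type u} {H : Type v} [Field k] [Ring H] [Algebra k H]
    [FiniteDimensional k H] (Q : QuasiHopfAlgebra k H) :
    (∃! μ : H →ₐ[k] k, Q.IsModulus μ) ∧
    (∃! γ : H →ₐ[k] k, Q.ActsOnCointegralsBy γ) ∧
    (∀ μ : H →ₐ[k] k, Q.IsModulus μ →
      (∀ γ : H →ₐ[k] k, Q.ActsOnCointegralsBy γ → γ = μ) ∧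
      (∀ lam ∈ Q.leftCointegrals, lam ≠ 0 →
        ∃ hlam : IsNondegenerateFunctional lam,
          ∀ a : H, modularAut lam hlam a = Q.S (Q.hit (Q.S a) μ.toLinearMap))) ∧
    (Q.IsUnimodular ↔
      ∀ lam ∈ Q.leftCointegrals, ∀ a b : H, lam (a * b) = lam (b * Q.S (Q.S a))) := by
  obtain ⟨lam₀, h₀, hne⟩ := Q.exists_mem_leftCointegrals_ne_zero
  have hlam₀ := Q.isNondegenerate_of_mem h₀ hne
  have hγ := Q.existsUnique_actsOnCointegralsBy
  obtain ⟨γ, hact, huniq⟩ := hγ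
  have hmod : Q.IsModulus γ := ⟨lam₀, hlam₀, Q.eq_counit_comp_modularAut_symm hact h₀ hlam₀⟩
  refine ⟨⟨γ, hmod, fun μ hμ => Q.eq_of_isModulus hμ hmod⟩, ⟨γ, hact, huniq⟩, ?_, ?_, ?_⟩
  · intro μ hμ
    obtain rfl := Q.eq_of_isModulus hμ hmod
    exact ⟨huniq, fun lam h h0 => ⟨Q.isNondegenerate_of_mem h h0, Q.modularAut_of_mem hact h _⟩⟩
  · intro hu lam h a b
    obtain rfl := Q.eq_of_isModulus hu hmod
    rcases eq_or_ne lam 0 with rfl | h0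
    · rfl
    · have hlam := Q.isNondegenerate_of_mem h h0
      rw [← modularAut_spec lam hlam, Q.modularAut_of_mem hact h hlam, Q.hit_counit]
  · intro hS
    have hε : γ = Q.counit := by
      ext c
      have h1 : Q.S (Q.hit c γ.toLinearMap) = Q.S c := by
        apply rightForm_injective hlam₀
        ext b
        have h2 := Q.modularAut_of_mem hact h₀ hlam₀ (Q.S.symm c)
        rw [LinearEquiv.apply_symm_apply] at h2
        rw [← h2, rightForm_apply, rightForm_apply, modularAut_spec, hS lam₀ h₀,
          LinearEquiv.apply_symm_apply]
      have h3 := Q.counit_hit c γ.toLinearMap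
      rw [Q.S.injective h1] at h3
      exact h3.symm
    rwa [hε] at hmod
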